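/- A configuration is a set $X=\{v_1,\dots,v_5\}$ of five distinct points on the unit sphere $S^2\subset\mathbb R^3$; two configurations are identified if they are isometric. For $s\in\mathbb R$ let $R_s(r)=\operatorname{sign}(s)\,r^{-s}$, and write $R_s(X)=\sum_{i<j}R_s(\|v_i-v_j\|)$. Let TBP be the triangular bi-pyramid: the two poles together with an equilateral triangle on the equator. Let $\Sigma(x,y,z)=\left(\frac{x}{1-z},\frac{y}{1-z}\right)$. A $4$-tuple $(p_0,p_1,p_2,p_3)$ of distinct points of $\mathbb R^2$ represents the configuration $\{V_0,V_1,V_2,V_3,(0,0,1)\}$ with $\Sigma(V_k)=p_k$, and everything isometric to it. Let - $\mathrm{K4}$ be the set of tuples $(p_0,p_1,p_2,p_3)$ that are the successive vertices of a rhombus and lie on the coordinate axes; - $\mathrm{SMALL}$ be the set of tuples with $\|p_0\|\ge\|p_k\|$ for $k=1,2,3$ and $512p_0\in[433,498]\times\{0\}$, $512p_1\in[-16,16]\times[-464,-349]$, $512p_2\in[-498,-400]\times[0,24]$, $512p_3\in[-16,16]\times[349,464]$; - $\mathrm{SMALL4}$ be the union of $\mathrm{K4}\cap\mathrm{SMALL}$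 and the set of tuples $-p_2=p_0=(x,0)$, $-p_1=p_3=(0,y)$ with $x\ge y$ and $x,y\in\left[\frac{348}{512},\frac{495}{512}\right]$; - $\mathrm{TINY4}$ be the set of tuples in $\mathrm{K4}$ with $-p_2,p_0\in I\times\{0\}$ and $-p_1,p_3\in\{0\}\times I$, where $I=\left(\frac{55}{64},\frac{56}{64}\right)$ is open. **Lemma.** Let $s\in\mathbb R$ and let $X$ be a configuration. Suppose that one of the following is true: 1. $s\in\left[13,15+\frac{24}{512}\right]$ and $X$ is represented by a tuple in $\mathrm{SMALL4}$; 2. $s\in\left[15+\frac{24}{512},15+\frac{25}{512}\right]$ and $X$ is represented by a tuple in $\mathrm{SMALL4}\setminus\mathrm{TINY4}$. Then $R_s(X)>R_s(\mathrm{TBP})$. -/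

import Mathlib

open Set

/-- Euclidean `3`-space. -/
abbrev E3 := EuclideanSpace ℝ (Fin 3)

/-- The Euclidean plane. -/
abbrev E2 := EuclideanSpace ℝ (Fin 2)

/-- A `5`-point configuration: five distinct points on the unit sphere. -/
structure Configuration where
  point : Fin 5 → E3
  norm_point : ∀ i, ‖point i‖ = 1
  injective_point : Function.Injective point

/-- The Riesz potential `R_s(r) = sign(s) r^(-s)`. -/
noncomputable def riesz (s r : ℝ) : ℝ := Real.sign s * r ^ (-s)

/-- The total potential of a configuration: the sum of `f ‖p_i - p_j‖` over the pairs `i < j`. -/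
noncomputable def energy (f : ℝ → ℝ) (X : Configuration) : ℝ :=
  ∑ i : Fin 5, ∑ j ∈ Finset.Ioi i, f ‖X.point i - X.point j‖

/-- Two configurations are the same if they are isometric (the labelling is immaterial). -/
def Configuration.Isometric (X Y : Configuration) : Prop :=
  ∃ σ : Equiv.Perm (Fin 5), ∀ i j,
    dist (X.point (σ i)) (X.point (σ j)) = dist (Y.point i) (Y.point j)

/-- The vertices of the triangular bi-pyramid: the two poles and an equilateral triangle on the
equator. -/
noncomputable def tbpPoint : Fin 5 → E3 :=
  ![!₂[0, 0, 1], !₂[0, 0, -1], !₂[1, 0, 0],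
    !₂[-(1 / 2), √3 / 2, 0], !₂[-(1 / 2), -(√3 / 2), 0]]

/-- The triangular bi-pyramid. -/
noncomputable def TBP : Configuration where
  point := tbpPoint
  norm_point := by
    intro i
    have h3 : (√3 : ℝ) ^ 2 = 3 := Real.sq_sqrt (by norm_num)
    fin_cases i <;>
      simp [tbpPoint, EuclideanSpace.norm_eq, Fin.sum_univ_three, div_pow, h3] <;> norm_num
  injective_point := by
    have h3 : (0 : ℝ) < √3 := Real.sqrt_pos.mpr (by norm_num)
    intro i j h
    have h0 := congrArg (fun v : E3 => v 0) h
    have h1 := congrArg (fun v : E3 => v 1) h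
    have h2 := congrArg (fun v : E3 => v 2) h
    fin_cases i <;> fin_cases j <;> simp [tbpPoint] at h0 h1 h2 ⊢ <;> linarith

/-- The north pole `(0, 0, 1)`. -/
noncomputable def northPole : E3 := !₂[0, 0, 1]

/-- Stereographic projection from the north pole (meaningful away from the north pole). -/
noncomputable def stereo (v : E3) : E2 := !₂[v 0 / (1 - v 2), v 1 / (1 - v 2)]

/-- `V` is the configuration `V_0, V_1, V_2, V_3, (0, 0, 1)` whose stereographic coordinates
`Σ(V_k)` are `p_0, p_1, p_2, p_3`.  The points of `V` being distinct, `V_0, ..., V_3` are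
not the north pole. -/
def Configuration.HasStereoCoords (V : Configuration) (p : Fin 4 → E2) : Prop :=
  V.point (Fin.last 4) = northPole ∧ ∀ k : Fin 4, stereo (V.point k.castSucc) = p k

/-- `X` belongs, up to isometry, to the family of configurations which are represented by the
`4`-tuples of stereographic coordinates in `S`. -/
def Configuration.Mem (X : Configuration) (S : Set (Fin 4 → E2)) : Prop :=
  ∃ p ∈ S, ∃ V : Configuration, V.HasStereoCoords p ∧ X.Isometric V

/-- The region `SMALL` in stereographic coordinates. -/
def SMALL : Set (Fin 4 → E2) :=
  {p | (∀ k, ‖p k‖ ≤ ‖p 0‖) ∧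
    (512 * p 0 0 ∈ Icc (433 : ℝ) 498 ∧ 512 * p 0 1 ∈ Icc (0 : ℝ) 0) ∧
    (512 * p 1 0 ∈ Icc (-16 : ℝ) 16 ∧ 512 * p 1 1 ∈ Icc (-464 : ℝ) (-349)) ∧
    (512 * p 2 0 ∈ Icc (-498 : ℝ) (-400) ∧ 512 * p 2 1 ∈ Icc (0 : ℝ) 24) ∧
    (512 * p 3 0 ∈ Icc (-16 : ℝ) 16 ∧ 512 * p 3 1 ∈ Icc (349 : ℝ) 464)}

/-- `K4`: the `p_k` are the successive vertices of a (nondegenerate) rhombus and lie on the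
coordinate axes. -/
def K4 : Set (Fin 4 → E2) :=
  {p | Function.Injective p ∧ p 0 + p 2 = p 1 + p 3 ∧ ‖p 0 - p 1‖ = ‖p 1 - p 2‖ ∧
    ∀ k, p k 0 = 0 ∨ p k 1 = 0}

/-- The explicit two-parameter family `-p_2 = p_0 = (x, 0)`, `-p_1 = p_3 = (0, y)` with `x ≥ y`
and `x, y ∈ [348/512, 495/512]`. -/
def SMALL4Square : Set (Fin 4 → E2) :=
  {p | ∃ x y : ℝ, -p 2 = p 0 ∧ p 0 = !₂[x, 0] ∧ -p 1 = p 3 ∧ p 3 = !₂[0, y] ∧ y ≤ x ∧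
    x ∈ Icc (348 / 512 : ℝ) (495 / 512) ∧ y ∈ Icc (348 / 512 : ℝ) (495 / 512)}

/-- The region `SMALL4`.  The two available descriptions, `K4 ∩ SMALL` and the explicit family
above, differ slightly near the boundary; their union is taken, so that both are covered. -/
def SMALL4 : Set (Fin 4 → E2) := (K4 ∩ SMALL) ∪ SMALL4Square

/-- The open square `TINY4` of configurations in `K4`: the points `-p_2, p_0` lie in `I × {0}` and
the points `-p_1, p_3` lie in `{0} × I`, where `I = (55/64, 56/64)`. -/
def TINY4 : Set (Fin 4 → E2) :=
  {p | p ∈ K4 ∧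
    (-p 2 0 ∈ Ioo (55 / 64 : ℝ) (56 / 64) ∧ -p 2 1 = 0) ∧
    (p 0 0 ∈ Ioo (55 / 64 : ℝ) (56 / 64) ∧ p 0 1 = 0) ∧
    (-p 1 0 = 0 ∧ -p 1 1 ∈ Ioo (55 / 64 : ℝ) (56 / 64)) ∧
    (p 3 0 = 0 ∧ p 3 1 ∈ Ioo (55 / 64 : ℝ) (56 / 64))}

/-! ### Lower bounds for powers -/

/-! Put t = s/2 and give each pair of points the variable r = 2/dist². Up to the factor 2^t the
Riesz energy is then the sum of r^t over pairs. The bi-pyramid gives 6 + 3(2/3)^t + (1/2)^t. Every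
tuple in `SMALL4` is (±x, 0), (0, ±y), and its energy `pyramidEnergy` depends only on a = x² and b =
y².

The exponent is removed by convexity. Each r^t lies above its tangent in t at the upper end t₁, and
the bi-pyramid energy lies below its chord on [t₁ - τ, t₁]. By `tbpEnergy_lt_of_interp` two
inequalities in (a, b) suffice: the true one at t₁, and one at t₁ - τ = 13/2 with r^t replaced by
`expTangent`.

For a fixed exponent, each power is bounded below by a tangent line in r whose rational coefficients
come from comparisons P^n ≤ r₀^m. After multiplication by σ = a + b, what remains is a quadratic in
σ that is concave in δ = a - b. On each strip of δ it is settled by discriminants at the two ends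
(`affine_add_cross_pos`, `pyramidEnergy_gt_of_tangents`).

At the upper exponent near a = b the margin is too thin for first-order tangents. There
`rpow_add_rpow_ge` keeps the δ² gain. The resulting bound dips slightly below zero on the diagonal
at t₁ = 459/61. Outside the exceptional square, either δ or the distance of σ from its minimiser
makes up for this. Inside the square only t ≤ 963/128 is needed, and there the diagonal bound is
positive. -/

theorem le_rpow_of_pow_le {P r : ℝ} {t : ℝ} {m n : ℕ} (hn : n ≠ 0) (ht : t * n = m)
    (hr : 0 ≤ r) (h : P ^ n ≤ r ^ m) : P ≤ r ^ t := by
  refine le_of_pow_le_pow_left₀ hn (Real.rpow_nonneg hr t) (h.trans_eq ?_)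
  rw [← Real.rpow_mul_natCast hr, ht, Real.rpow_natCast]

theorem rpow_le_of_le_pow {Q r : ℝ} {t : ℝ} {m n : ℕ} (hn : n ≠ 0) (ht : t * n = m)
    (hQ : 0 ≤ Q) (hr : 0 ≤ r) (h : r ^ m ≤ Q ^ n) : r ^ t ≤ Q := by
  refine le_of_pow_le_pow_left₀ hn hQ (le_trans (le_of_eq ?_) h)
  rw [← Real.rpow_mul_natCast hr, ht, Real.rpow_natCast]

/-- Bernoulli's inequality for (r/r₀)^t, scaled by r₀^t. A lower approximation P of r₀^t is enough:
where the tangent line is negative there is nothing to prove, and elsewhere decreasing P only lowers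
it. -/
theorem tangent_le_rpow {P t r₀ r : ℝ} (ht : 1 ≤ t) (hr₀ : 0 < r₀) (hP : 0 ≤ P)
    (hPr : P ≤ r₀ ^ t) (hr : 0 < r) : P * (1 - t) + P * t / r₀ * r ≤ r ^ t := by
  have e : P * (1 - t) + P * t / r₀ * r = P * (1 + t * (r / r₀ - 1)) := by ring
  have hx : 0 < r / r₀ := div_pos hr hr₀
  rw [e]
  rcases le_total (1 + t * (r / r₀ - 1)) 0 with h | h
  · exact (mul_nonpos_of_nonneg_of_nonpos hP h).trans (Real.rpow_nonneg hr.le t)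
  · have hb := one_add_mul_self_le_rpow_one_add (s := r / r₀ - 1) (by linarith) ht
    rw [add_sub_cancel] at hb
    calc P * (1 + t * (r / r₀ - 1)) ≤ r₀ ^ t * (r / r₀) ^ t :=
          mul_le_mul hPr hb h (Real.rpow_nonneg hr₀.le t)
      _ = r ^ t := by
          rw [← Real.mul_rpow hr₀.le hx.le, mul_div_cancel₀ _ hr₀.ne']

/-- Since (1 - l/32)^32 ≤ exp(-l), an upper bound on a logarithm becomes a comparison of rationals.
-/
theorem log_le_neg_of_le_pow {r l : ℝ} (hr : 0 < r) (hl : l ≤ 32)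
    (h : r ≤ (1 - l / 32) ^ 32) : Real.log r ≤ -l := by
  rw [Real.log_le_iff_le_exp hr]
  calc r ≤ (1 - l / 32) ^ 32 := h
    _ ≤ (Real.exp (-(l / 32))) ^ 32 :=
        pow_le_pow_left₀ (by linarith) (by linarith [Real.add_one_le_exp (-(l / 32))]) _
    _ = Real.exp (-l) := by rw [← Real.exp_nat_mul]; congr 1; push_cast; ring

/-- The extrapolation to `t - τ` of `x ^ t` along its tangent in the exponent. -/
noncomputable def expTangent (t τ r : ℝ) : ℝ := r ^ t * (1 - τ * Real.log r)

/-- The left side is the tangent at x = 1 of the right side. Bernoulli with exponent t/2, squared,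
bounds x^t by a quadratic, and the difference becomes (x - 1)² t/4 times the slack in `hxK`. Where
Bernoulli's lower bound is nonpositive and cannot be squared, `hK` makes the tangent nonpositive. -/
theorem affine_le_rpow_mul {t τ K x : ℝ} (ht : 2 ≤ t) (hτ : 0 ≤ τ) (hK : 2 * τ ≤ t * K)
    (hx : 0 < x) (hxK : τ * (t * (x - 1) + 4) ≤ t * K) :
    K + (t * K - τ) * (x - 1) ≤ x ^ t * (K - τ * (x - 1)) := by
  have ht0 : 0 < t := by linarith
  have hpos : 0 ≤ K - τ * (x - 1) := by
    have : 0 ≤ t * (K - τ * (x - 1)) := by nlinarith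
    exact nonneg_of_mul_nonneg_right this ht0
  rcases le_total (1 + t / 2 * (x - 1)) 0 with h | h
  · refine le_trans ?_ (mul_nonneg (Real.rpow_nonneg hx.le t) hpos)
    have hKt : 0 ≤ t * K - τ := by linarith
    have h2 : t * (K + (t * K - τ) * (x - 1)) ≤ 0 := by
      nlinarith [mul_nonneg hKt (neg_nonneg.mpr h)]
    nlinarith
  · have hb := one_add_mul_self_le_rpow_one_add (s := x - 1) (p := t / 2) (by linarith)
      (by linarith)
    rw [add_sub_cancel] at hb
    have hb2 : (1 + t / 2 * (x - 1)) ^ 2 ≤ x ^ t := by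
      have := pow_le_pow_left₀ h hb 2
      rwa [← Real.rpow_mul_natCast hx.le, Nat.cast_ofNat, div_mul_cancel₀ _ two_ne_zero] at this
    refine le_trans ?_ (mul_le_mul_of_nonneg_right hb2 hpos)
    have : 0 ≤ (x - 1) ^ 2 * t * (t * K - τ * (t * (x - 1) + 4)) :=
      mul_nonneg (mul_nonneg (sq_nonneg _) ht0.le) (by linarith)
    nlinarith

/-- With x = r/r₀, log r ≤ -l + (x - 1) turns `expTangent` into r₀^t times the product treated in
`affine_le_rpow_mul`. The bound R is needed because that estimate fails for large r. -/
theorem tangent_le_expTangent {P t τ l R r₀ r : ℝ} (ht : 2 ≤ t) (hτ : 0 ≤ τ) (hr₀ : 0 < r₀)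
    (hP : 0 ≤ P) (hPr : P ≤ r₀ ^ t) (hl : l ≤ 32) (hlr : r₀ ≤ (1 - l / 32) ^ 32)
    (hK : 2 * τ ≤ t * (1 + τ * l)) (hR : τ * (t * (R / r₀ - 1) + 4) ≤ t * (1 + τ * l))
    (hr : 0 < r) (hrR : r ≤ R) :
    P * ((1 + τ * l) * (1 - t) + τ) + P * (t * (1 + τ * l) - τ) / r₀ * r ≤ expTangent t τ r := by
  set K := 1 + τ * l with hKdef
  have hx : 0 < r / r₀ := div_pos hr hr₀
  have hlog : Real.log r ≤ -l + (r / r₀ - 1) := by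
    have h1 : Real.log r = Real.log r₀ + Real.log (r / r₀) := by
      rw [Real.log_div hr.ne' hr₀.ne']; ring
    rw [h1]
    exact add_le_add (log_le_neg_of_le_pow hr₀ hl hlr) (Real.log_le_sub_one_of_pos hx)
  have hxR : r / r₀ ≤ R / r₀ := div_le_div_of_nonneg_right hrR hr₀.le
  have hxK : τ * (t * (r / r₀ - 1) + 4) ≤ t * K := by
    refine le_trans (mul_le_mul_of_nonneg_left ?_ hτ) hR
    nlinarith
  have hpos : 0 ≤ K - τ * (r / r₀ - 1) := by
    have : 0 ≤ t * (K - τ * (r / r₀ - 1)) := by nlinarith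
    exact nonneg_of_mul_nonneg_right this (by linarith)
  have key := affine_le_rpow_mul ht hτ hK hx hxK
  have hlow : r ^ t * (K - τ * (r / r₀ - 1)) ≤ expTangent t τ r := by
    refine mul_le_mul_of_nonneg_left ?_ (Real.rpow_nonneg hr.le t)
    nlinarith [mul_le_mul_of_nonneg_left hlog hτ]
  have e : P * (K * (1 - t) + τ) + P * (t * K - τ) / r₀ * r
      = P * (K + (t * K - τ) * (r / r₀ - 1)) := by ring
  rw [e]
  have hrt : r ^ t = r₀ ^ t * (r / r₀) ^ t := by
    rw [← Real.mul_rpow hr₀.le hx.le, mul_div_cancel₀ _ hr₀.ne']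
  refine le_trans ?_ hlow
  rw [hrt, mul_assoc]
  refine (mul_le_mul_of_nonneg_left key hP).trans ?_
  exact mul_le_mul_of_nonneg_right hPr (mul_nonneg (Real.rpow_nonneg hx.le t) hpos)

/-! ### Convexity in the exponent -/

/-- Tangent line to the convex function t ↦ r^t, from 1 + y ≤ exp y. -/
theorem expTangent_interp {t τ r θ : ℝ} (hr : 0 < r) :
    (1 - θ) * r ^ t + θ * expTangent t τ r ≤ r ^ (t - θ * τ) := by
  have h : r ^ (t - θ * τ) = r ^ t * Real.exp (-(θ * τ) * Real.log r) := by
    rw [sub_eq_add_neg, Real.rpow_add hr, Real.rpow_def_of_pos hr (-(θ * τ)), mul_comm (Real.log r)]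
  rw [h, expTangent]
  have := mul_le_mul_of_nonneg_left (Real.add_one_le_exp (-(θ * τ) * Real.log r))
    (Real.rpow_nonneg hr.le t)
  nlinarith

/-- Chord of the same convex function, as weighted AM-GM. -/
theorem rpow_le_interp {t τ r θ : ℝ} (hr : 0 < r) (h0 : 0 ≤ θ) (h1 : θ ≤ 1) :
    r ^ (t - θ * τ) ≤ (1 - θ) * r ^ t + θ * r ^ (t - τ) := by
  have := Real.geom_mean_le_arith_mean2_weighted (sub_nonneg.mpr h1) h0
    (Real.rpow_nonneg hr.le t) (Real.rpow_nonneg hr.le (t - τ)) (by ring)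
  rw [← Real.rpow_mul hr.le, ← Real.rpow_mul hr.le, ← Real.rpow_add hr] at this
  convert this using 2
  ring

/-! ### Second-order gain for a symmetric pair -/

/-- Two integrations from 0: the second derivative of the difference is nonnegative, by Bernoulli
for (1 ± z)^(t-2), whose linear terms cancel. -/
theorem two_add_sq_le_rpow_add_rpow {t z : ℝ} (ht : 3 ≤ t) (h0 : 0 ≤ z) (h1 : z < 1) :
    2 + t * (t - 1) * z ^ 2 ≤ (1 + z) ^ t + (1 - z) ^ t := by
  have d1 : ∀ p : ℝ, ∀ z ∈ Ico (0 : ℝ) 1, HasDerivAt (fun z : ℝ => (1 + z) ^ p) (p * (1 + z) ^ (p - 1)) z := by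
    intro p z hz
    have := ((hasDerivAt_id z).const_add 1).rpow_const (p := p) (Or.inl (by simp; linarith [hz.1]))
    simpa using this
  have d2 : ∀ p : ℝ, ∀ z ∈ Ico (0 : ℝ) 1, HasDerivAt (fun z : ℝ => (1 - z) ^ p) (-(p * (1 - z) ^ (p - 1))) z := by
    intro p z hz
    have := ((hasDerivAt_id z).const_sub 1).rpow_const (p := p) (Or.inl (by simp; linarith [hz.2]))
    simpa using this
  have conv : Convex ℝ (Ico (0 : ℝ) 1) := convex_Ico 0 1
  have m1 : MonotoneOn (fun z : ℝ => (1 + z) ^ (t - 1) - (1 - z) ^ (t - 1) - 2 * (t - 1) * z) (Ico 0 1) := by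
    have hd : ∀ z ∈ Ico (0 : ℝ) 1, HasDerivAt (fun z : ℝ => (1 + z) ^ (t - 1) - (1 - z) ^ (t - 1) - 2 * (t - 1) * z)
        ((t - 1) * (1 + z) ^ (t - 1 - 1) - -((t - 1) * (1 - z) ^ (t - 1 - 1)) - 2 * (t - 1)) z := by
      intro z hz
      have := ((d1 (t - 1) z hz).sub (d2 (t - 1) z hz)).sub ((hasDerivAt_id z).const_mul (2 * (t - 1)))
      exact this.congr_deriv (by ring)
    refine monotoneOn_of_deriv_nonneg conv
      (fun z hz => (hd z hz).continuousAt.continuousWithinAt)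
      (fun z hz => (hd z (interior_subset hz)).differentiableAt.differentiableWithinAt) ?_
    intro z hz
    have hz' := interior_subset hz
    rw [(hd z hz').deriv]
    have b1 := one_add_mul_self_le_rpow_one_add (s := z) (p := t - 1 - 1) (by linarith [hz'.1]) (by linarith)
    have b2 := one_add_mul_self_le_rpow_one_add (s := -z) (p := t - 1 - 1) (by linarith [hz'.2]) (by linarith)
    rw [← sub_eq_add_neg] at b2
    nlinarith
  have m2 : MonotoneOn (fun z : ℝ => (1 + z) ^ t + (1 - z) ^ t - t * (t - 1) * z ^ 2) (Ico 0 1) := by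
    have hd : ∀ z ∈ Ico (0 : ℝ) 1, HasDerivAt (fun z : ℝ => (1 + z) ^ t + (1 - z) ^ t - t * (t - 1) * z ^ 2)
        (t * (1 + z) ^ (t - 1) + -(t * (1 - z) ^ (t - 1)) - t * (t - 1) * (2 * z)) z := by
      intro z hz
      have := ((d1 t z hz).add (d2 t z hz)).sub ((hasDerivAt_pow 2 z).const_mul (t * (t - 1)))
      exact this.congr_deriv (by simp)
    refine monotoneOn_of_deriv_nonneg conv
      (fun z hz => (hd z hz).continuousAt.continuousWithinAt)
      (fun z hz => (hd z (interior_subset hz)).differentiableAt.differentiableWithinAt) ?_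
    intro z hz
    have hz' := interior_subset hz
    rw [(hd z hz').deriv]
    have := m1 (left_mem_Ico.mpr one_pos) hz' hz'.1
    simp only [add_zero, sub_zero, Real.one_rpow, mul_zero, sub_self] at this
    nlinarith
  have := m2 (left_mem_Ico.mpr one_pos) ⟨h0, h1⟩ h0
  simp only [add_zero, sub_zero, Real.one_rpow, ne_eq, OfNat.ofNat_ne_zero, not_false_eq_true, zero_pow, mul_zero] at this
  linarith

theorem rpow_add_rpow_ge {t m e : ℝ} (ht : 3 ≤ t) (he : 0 ≤ e) (hem : e < m) :
    2 * m ^ t + t * (t - 1) * m ^ (t - 2) * e ^ 2 ≤ (m + e) ^ t + (m - e) ^ t := by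
  have hm : 0 < m := he.trans_lt hem
  have h := mul_le_mul_of_nonneg_left
    (two_add_sq_le_rpow_add_rpow ht (div_nonneg he hm.le) ((div_lt_one hm).mpr hem))
    (Real.rpow_nonneg hm.le t)
  have hz : e / m < 1 := (div_lt_one hm).mpr hem
  rw [mul_add (m ^ t) ((1 + e / m) ^ t), ← Real.mul_rpow hm.le (by positivity),
    ← Real.mul_rpow hm.le (by linarith)] at h
  have e1 : m * (1 + e / m) = m + e := by field_simp
  have e2 : m * (1 - e / m) = m - e := by field_simp
  rw [e1, e2] at h
  refine le_trans (le_of_eq ?_) h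
  rw [Real.rpow_sub hm, Real.rpow_two]
  field_simp

/-! ### The energy of a square-based family -/

/-- The rescaled energy, for the potential `Φ` as a function of `2 / dist ^ 2`, of the configuration
with stereographic coordinates `(±√a, 0)` and `(0, ±√b)`. -/
noncomputable def pyramidEnergy (Φ : ℝ → ℝ) (a b : ℝ) : ℝ :=
  2 * Φ ((1 + a) / 2) + 2 * Φ ((1 + b) / 2) + Φ ((1 + a) ^ 2 / (8 * a))
    + Φ ((1 + b) ^ 2 / (8 * b)) + 4 * Φ ((1 + a) * (1 + b) / (2 * (a + b)))

/-- The rescaled energy of the triangular bi-pyramid. -/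
noncomputable def tbpEnergy (t : ℝ) : ℝ := 6 + 3 * (2 / 3 : ℝ) ^ t + (1 / 2 : ℝ) ^ t

/-- `A + B r ≤ Φ r` for `0 < r ≤ R`. -/
def AffineBelow (Φ : ℝ → ℝ) (R A B : ℝ) : Prop := ∀ r, 0 < r → r ≤ R → A + B * r ≤ Φ r

/-- The squared coordinates `(a, b)` of the configurations under consideration, roughly. -/
structure InRange (a b : ℝ) : Prop where
  le : b ≤ a
  lower : 23 / 50 ≤ b
  upper : a ≤ 19 / 20
  sub_le : a - b ≤ 97 / 200

/-! ### Affine minorants and reduction to discriminants -/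

theorem affineBelow_rpow {P t r₀ R : ℝ} {m n : ℕ} (hn : n ≠ 0) (htn : t * n = m) (ht : 1 ≤ t)
    (hr₀ : 0 < r₀) (hP : 0 ≤ P) (h : P ^ n ≤ r₀ ^ m) :
    AffineBelow (fun r => r ^ t) R (P * (1 - t)) (P * t / r₀) := fun _ hr _ =>
  tangent_le_rpow ht hr₀ hP (le_rpow_of_pow_le hn htn hr₀.le h) hr

theorem affineBelow_expTangent {P t τ l R r₀ : ℝ} {m n : ℕ} (hn : n ≠ 0) (htn : t * n = m)
    (ht : 2 ≤ t) (hτ : 0 ≤ τ) (hr₀ : 0 < r₀) (hP : 0 ≤ P) (h : P ^ n ≤ r₀ ^ m) (hl : l ≤ 32)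
    (hlr : r₀ ≤ (1 - l / 32) ^ 32) (hK : 2 * τ ≤ t * (1 + τ * l))
    (hR : τ * (t * (R / r₀ - 1) + 4) ≤ t * (1 + τ * l)) :
    AffineBelow (expTangent t τ) R (P * ((1 + τ * l) * (1 - t) + τ))
      (P * (t * (1 + τ * l) - τ) / r₀) := fun _ hr hrR =>
  tangent_le_expTangent ht hτ hr₀ hP (le_rpow_of_pow_le hn htn hr₀.le h) hl hlr hK hR hr hrR

theorem half_one_add_mem {a b : ℝ} (h : InRange a b) :
    (0 < (1 + a) / 2 ∧ (1 + a) / 2 ≤ 1) ∧ (0 < (1 + b) / 2 ∧ (1 + b) / 2 ≤ 1) := by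
  obtain ⟨h1, h2, h3, -⟩ := h
  refine ⟨⟨?_, ?_⟩, ?_, ?_⟩ <;> linarith

theorem sq_one_add_div_mem {a : ℝ} (h2 : 23 / 50 ≤ a) (h3 : a ≤ 19 / 20) :
    0 < (1 + a) ^ 2 / (8 * a) ∧ (1 + a) ^ 2 / (8 * a) ≤ 3 / 5 := by
  have : 0 < a := by linarith
  refine ⟨by positivity, ?_⟩
  rw [div_le_iff₀ (by linarith)]
  nlinarith

theorem cross_mem {a b : ℝ} (h : InRange a b) :
    0 < (1 + a) * (1 + b) / (2 * (a + b)) ∧ (1 + a) * (1 + b) / (2 * (a + b)) ≤ 6 / 5 := by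
  obtain ⟨h1, h2, h3, -⟩ := h
  have ha : 0 < a := by linarith
  have hb : 0 < b := by linarith
  refine ⟨by positivity, ?_⟩
  rw [div_le_iff₀ (by linarith)]
  nlinarith [mul_nonneg (sub_nonneg.mpr h2) (sub_nonneg.mpr h3)]

/-- Tangent at a₀ to the convex function (2 + a + 1/a)/8. -/
theorem sq_one_add_div_ge {a a₀ : ℝ} (ha : 0 < a) (ha₀ : 0 < a₀) :
    (2 + 2 / a₀ + a * (1 - 1 / a₀ ^ 2)) / 8 ≤ (1 + a) ^ 2 / (8 * a) := by
  have h : (1 + a) ^ 2 / (8 * a) - (2 + 2 / a₀ + a * (1 - 1 / a₀ ^ 2)) / 8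
      = (a - a₀) ^ 2 / (8 * a * a₀ ^ 2) := by field_simp; ring
  have : 0 ≤ (a - a₀) ^ 2 / (8 * a * a₀ ^ 2) := by positivity
  linarith

theorem quadratic_pos_of_discrim_neg {A B C x : ℝ} (hA : 0 < A) (h : B ^ 2 < 4 * A * C) :
    0 < A * x ^ 2 + B * x + C := by
  have : 0 < 4 * A * (A * x ^ 2 + B * x + C) := by nlinarith [sq_nonneg (2 * A * x + B)]
  exact pos_of_mul_pos_right this (by linarith)

/-- A function of `δ` that is concave is positive between points where it is positive. -/
theorem pos_of_concave_quadratic {c₀ c₁ c₂ δ₀ δ₁ δ : ℝ} (hc₂ : 0 ≤ c₂) (h0 : δ₀ ≤ δ) (h1 : δ ≤ δ₁)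
    (p0 : 0 < c₀ + c₁ * δ₀ - c₂ * δ₀ ^ 2) (p1 : 0 < c₀ + c₁ * δ₁ - c₂ * δ₁ ^ 2) :
    0 < c₀ + c₁ * δ - c₂ * δ ^ 2 := by
  rcases h0.eq_or_lt with rfl | h0'
  · exact p0
  have hd : 0 < δ₁ - δ₀ := by linarith
  have : (δ₁ - δ₀) * (c₀ + c₁ * δ - c₂ * δ ^ 2) = (δ₁ - δ) * (c₀ + c₁ * δ₀ - c₂ * δ₀ ^ 2)
      + (δ - δ₀) * (c₀ + c₁ * δ₁ - c₂ * δ₁ ^ 2) + c₂ * (δ₁ - δ₀) * ((δ - δ₀) * (δ₁ - δ)) := by ring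
  have h2 : 0 < (δ₁ - δ₀) * (c₀ + c₁ * δ - c₂ * δ ^ 2) := by
    rw [this]
    have t1 := mul_nonneg (sub_nonneg.mpr h1) p0.le
    have t2 := mul_pos (sub_pos.mpr h0') p1
    have t3 := mul_nonneg (mul_nonneg hc₂ hd.le) (mul_nonneg (sub_nonneg.mpr h0) (sub_nonneg.mpr h1))
    linarith
  exact pos_of_mul_pos_right h2 hd.le

/-- With σ = a + b and δ = a - b, one has ab = (σ² - δ²)/4, so σ times the expression is quadratic
in σ and concave in δ. It is therefore enough to have no real root in σ at δ₀ and at δ₁. -/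
theorem affine_add_cross_pos {α β γ κ δ₀ δ₁ a b : ℝ} (ha : 0 < a) (hb : 0 < b) (hκ : 0 ≤ κ)
    (hB : 0 < (β + γ) / 2 + κ / 4) (h0 : δ₀ ≤ a - b) (h1 : a - b ≤ δ₁)
    (d0 : (α + (β - γ) / 2 * δ₀) ^ 2 < 4 * ((β + γ) / 2 + κ / 4) * (κ * (1 - δ₀ ^ 2 / 4)))
    (d1 : (α + (β - γ) / 2 * δ₁) ^ 2 < 4 * ((β + γ) / 2 + κ / 4) * (κ * (1 - δ₁ ^ 2 / 4))) :
    0 < α + β * a + γ * b + κ * ((1 + a * b) / (a + b)) := by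
  have p0 := quadratic_pos_of_discrim_neg (x := a + b) hB d0
  have p1 := quadratic_pos_of_discrim_neg (x := a + b) hB d1
  have key := pos_of_concave_quadratic (c₀ := ((β + γ) / 2 + κ / 4) * (a + b) ^ 2 + α * (a + b) + κ)
    (c₁ := (β - γ) / 2 * (a + b)) (c₂ := κ / 4) (by linarith) h0 h1 (by linarith) (by linarith)
  have hs : 0 < a + b := by linarith
  have e : α + β * a + γ * b + κ * ((1 + a * b) / (a + b))
      = (((β + γ) / 2 + κ / 4) * (a + b) ^ 2 + α * (a + b) + κ + (β - γ) / 2 * (a + b) * (a - b)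
        - κ / 4 * (a - b) ^ 2) / (a + b) := by
    field_simp; ring
  rw [e]
  exact div_pos key hs

theorem pyramidEnergy_gt_of_tangents {Φ : ℝ → ℝ} {Au Bu Aw Bw Ap Bp Aq Bq Av Bv : ℝ}
    {a b : ℝ} (a₀ b₀ δ₀ δ₁ T : ℝ) (hab : InRange a b) (h0 : δ₀ ≤ a - b) (h1 : a - b ≤ δ₁)
    (hu : AffineBelow Φ 1 Au Bu) (hw : AffineBelow Φ 1 Aw Bw) (hp : AffineBelow Φ (3 / 5) Ap Bp)
    (hq : AffineBelow Φ (3 / 5) Aq Bq) (hv : AffineBelow Φ (6 / 5) Av Bv)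
    (ha₀ : 0 < a₀) (hb₀ : 0 < b₀) (hBp : 0 ≤ Bp) (hBq : 0 ≤ Bq) (hBv : 0 ≤ Bv)
    {α β γ : ℝ}
    (hα : α ≤ 2 * Au + Bu + 2 * Aw + Bw + Ap + Bp * (1 + 1 / a₀) / 4 + Aq + Bq * (1 + 1 / b₀) / 4
      + 4 * Av + 2 * Bv - T)
    (hβ : β ≤ Bu + Bp / 8 * (1 - 1 / a₀ ^ 2)) (hγ : γ ≤ Bw + Bq / 8 * (1 - 1 / b₀ ^ 2))
    (hB : 0 < (β + γ) / 2 + 2 * Bv / 4)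
    (d0 : (α + (β - γ) / 2 * δ₀) ^ 2 < 4 * ((β + γ) / 2 + 2 * Bv / 4) * (2 * Bv * (1 - δ₀ ^ 2 / 4)))
    (d1 : (α + (β - γ) / 2 * δ₁) ^ 2 < 4 * ((β + γ) / 2 + 2 * Bv / 4) * (2 * Bv * (1 - δ₁ ^ 2 / 4))) :
    T < pyramidEnergy Φ a b := by
  have hb : 0 < b := by linarith [hab.lower]
  have ha : 0 < a := by linarith [hab.le]
  obtain ⟨⟨u0, u1⟩, w0, w1⟩ := half_one_add_mem hab
  obtain ⟨p0, p1⟩ := sq_one_add_div_mem (hab.lower.trans hab.le) hab.upper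
  obtain ⟨q0, q1⟩ := sq_one_add_div_mem hab.lower (hab.le.trans hab.upper)
  obtain ⟨v0, v1⟩ := cross_mem hab
  have iu := hu _ u0 u1
  have iw := hw _ w0 w1
  have ip := hp _ p0 p1
  have iq := hq _ q0 q1
  have iv := hv _ v0 v1
  have jp := mul_le_mul_of_nonneg_left (sq_one_add_div_ge ha ha₀) hBp
  have jq := mul_le_mul_of_nonneg_left (sq_one_add_div_ge hb hb₀) hBq
  have key := affine_add_cross_pos ha hb (by linarith : 0 ≤ 2 * Bv) hB h0 h1 d0 d1
  have e : (1 + a) * (1 + b) / (2 * (a + b)) = 1 / 2 + (1 + a * b) / (a + b) / 2 := by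
    field_simp; ring
  have kβ := mul_le_mul_of_nonneg_right hβ ha.le
  have kγ := mul_le_mul_of_nonneg_right hγ hb.le
  have ev : 4 * (Av + Bv * ((1 + a) * (1 + b) / (2 * (a + b))))
      = 4 * Av + 2 * Bv + 2 * Bv * ((1 + a * b) / (a + b)) := by rw [e]; ring
  have ep : Bp * ((2 + 2 / a₀ + a * (1 - 1 / a₀ ^ 2)) / 8)
      = Bp * (1 + 1 / a₀) / 4 + Bp / 8 * (1 - 1 / a₀ ^ 2) * a := by ring
  have eq : Bq * ((2 + 2 / b₀ + b * (1 - 1 / b₀ ^ 2)) / 8)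
      = Bq * (1 + 1 / b₀) / 4 + Bq / 8 * (1 - 1 / b₀ ^ 2) * b := by ring
  unfold pyramidEnergy
  linarith

/-- Second-order version of the tangent estimate near the diagonal `a = b`. -/
theorem pyramidEnergy_rpow_ge {t : ℝ} {Am Bm A' B' Ap Bp Av Bv : ℝ} {a b : ℝ} (a₀ : ℝ)
    (hab : InRange a b) (ht : 3 ≤ t)
    (hm : AffineBelow (fun r => r ^ t) 1 Am Bm) (hm' : AffineBelow (fun r => r ^ (t - 2)) 1 A' B')
    (hp : AffineBelow (fun r => r ^ t) (3 / 5) Ap Bp)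
    (hv : AffineBelow (fun r => r ^ t) (6 / 5) Av Bv) (ha₀ : 0 < a₀) (hBp : 0 ≤ Bp) :
    4 * Am + 2 * Bm + 2 * Ap + Bp * (1 + 1 / a₀) / 2 + 4 * Av + 2 * Bv
      + (Bm + Bp / 8 * (1 - 1 / a₀ ^ 2) + Bv / 2) * (a + b) + 2 * Bv / (a + b)
      + (a - b) ^ 2 * (t * (t - 1) / 8 * (A' + B' / 2 + B' / 4 * (a + b)) - Bv / 2 / (a + b))
      ≤ pyramidEnergy (fun r => r ^ t) a b := by
  have hb : 0 < b := by linarith [hab.lower]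
  have ha : 0 < a := by linarith [hab.le]
  obtain ⟨⟨u0, u1⟩, w0, w1⟩ := half_one_add_mem hab
  obtain ⟨p0, p1⟩ := sq_one_add_div_mem (hab.lower.trans hab.le) hab.upper
  obtain ⟨q0, q1⟩ := sq_one_add_div_mem hab.lower (hab.le.trans hab.upper)
  obtain ⟨v0, v1⟩ := cross_mem hab
  have h2 := rpow_add_rpow_ge (m := (2 + (a + b)) / 4) (e := (a - b) / 4) ht
    (by linarith [hab.le]) (by linarith)
  have eu : (2 + (a + b)) / 4 + (a - b) / 4 = (1 + a) / 2 := by ring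
  have ew : (2 + (a + b)) / 4 - (a - b) / 4 = (1 + b) / 2 := by ring
  rw [eu, ew] at h2
  have im := hm ((2 + (a + b)) / 4) (by linarith) (by linarith)
  have im' := mul_le_mul_of_nonneg_left (hm' ((2 + (a + b)) / 4) (by linarith) (by linarith))
    (mul_nonneg (mul_nonneg (by linarith : 0 ≤ t) (by linarith : 0 ≤ t - 1)) (sq_nonneg ((a - b) / 4)))
  have ip := hp _ p0 p1
  have iq := hp _ q0 q1
  have iv := hv _ v0 v1
  have jp := mul_le_mul_of_nonneg_left (sq_one_add_div_ge ha ha₀) hBp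
  have jq := mul_le_mul_of_nonneg_left (sq_one_add_div_ge hb ha₀) hBp
  have e : (1 + a) * (1 + b) / (2 * (a + b))
      = 1 / 2 + (a + b) / 8 + 1 / (2 * (a + b)) - (a - b) ^ 2 / (8 * (a + b)) := by
    field_simp; ring
  have ev : 4 * (Av + Bv * ((1 + a) * (1 + b) / (2 * (a + b))))
      = 4 * Av + 2 * Bv + Bv / 2 * (a + b) + 2 * Bv / (a + b)
        - (a - b) ^ 2 * (Bv / 2 / (a + b)) := by rw [e]; field_simp; ring
  have ep : Bp * ((2 + 2 / a₀ + a * (1 - 1 / a₀ ^ 2)) / 8) + Bp * ((2 + 2 / a₀ + b * (1 - 1 / a₀ ^ 2)) / 8)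
      = Bp * (1 + 1 / a₀) / 2 + Bp / 8 * (1 - 1 / a₀ ^ 2) * (a + b) := by ring
  unfold pyramidEnergy
  dsimp only at *
  linarith

/-- To bound the energy on an interval of exponents it suffices to bound it at the upper end, and to
bound its linear extrapolation at the lower end. -/
theorem tbpEnergy_lt_of_interp {t₁ τ t a b : ℝ} (hab : InRange a b) (hτ : 0 < τ)
    (h0 : t₁ - τ ≤ t) (h1 : t ≤ t₁)
    (F1 : tbpEnergy t₁ < pyramidEnergy (fun r => r ^ t₁) a b)
    (F2 : tbpEnergy (t₁ - τ) < pyramidEnergy (expTangent t₁ τ) a b) :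
    tbpEnergy t < pyramidEnergy (fun r => r ^ t) a b := by
  obtain ⟨⟨u0, -⟩, w0, -⟩ := half_one_add_mem hab
  obtain ⟨p0, -⟩ := sq_one_add_div_mem (hab.lower.trans hab.le) hab.upper
  obtain ⟨q0, -⟩ := sq_one_add_div_mem hab.lower (hab.le.trans hab.upper)
  obtain ⟨v0, -⟩ := cross_mem hab
  obtain ⟨θ, hθ⟩ : ∃ θ, θ = (t₁ - t) / τ := ⟨_, rfl⟩
  have ht : t = t₁ - θ * τ := by rw [hθ]; field_simp; ring
  have hθ0 : 0 ≤ θ := by rw [hθ]; exact div_nonneg (by linarith) hτ.le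
  have hθ1 : θ ≤ 1 := by rw [hθ, div_le_one hτ]; linarith
  rw [ht]
  have iu := expTangent_interp (t := t₁) (τ := τ) (θ := θ) u0
  have iw := expTangent_interp (t := t₁) (τ := τ) (θ := θ) w0
  have ip := expTangent_interp (t := t₁) (τ := τ) (θ := θ) p0
  have iq := expTangent_interp (t := t₁) (τ := τ) (θ := θ) q0
  have iv := expTangent_interp (t := t₁) (τ := τ) (θ := θ) v0
  have k1 := rpow_le_interp (t := t₁) (τ := τ) (r := 2 / 3) (by norm_num) hθ0 hθ1
  have k2 := rpow_le_interp (t := t₁) (τ := τ) (r := 1 / 2) (by norm_num) hθ0 hθ1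
  have key : 0 < (1 - θ) * (pyramidEnergy (fun r => r ^ t₁) a b - tbpEnergy t₁)
      + θ * (pyramidEnergy (expTangent t₁ τ) a b - tbpEnergy (t₁ - τ)) := by
    rcases hθ1.eq_or_lt with rfl | h
    · linarith
    · have := mul_pos (sub_pos.mpr h) (sub_pos.mpr F1)
      have := mul_nonneg hθ0 (sub_pos.mpr F2).le
      linarith
  unfold pyramidEnergy tbpEnergy at *
  linarith

/-! ### Numerical tangent estimates, by ranges of `a - b` -/

-- The rational certificates P^n ≤ r₀^m involve exponents up to 963.
set_option exponentiation.threshold 1000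

/-- The fraction 459/61 lies just above (15 + 25/512)/2 = 7705/1024 and has a much smaller
denominator, which keeps the certificates small. The step τ = 125/122 used with it leads down to
13/2. -/
theorem affineBelow_rpow61 {P r₀ R : ℝ} (hr₀ : 0 < r₀) (hP : 0 ≤ P) (h : P ^ 61 ≤ r₀ ^ 459) :
    AffineBelow (fun r => r ^ (459 / 61 : ℝ)) R (P * (1 - (459 / 61))) (P * (459 / 61) / r₀) :=
  affineBelow_rpow (n := 61) (m := 459) (by norm_num) (by norm_num) (by norm_num) hr₀ hP h

theorem affineBelow_expTangent61 {P l R r₀ : ℝ} (hr₀ : 0 < r₀) (hP : 0 ≤ P) (h : P ^ 61 ≤ r₀ ^ 459)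
    (hl : l ≤ 32) (hlr : r₀ ≤ (1 - l / 32) ^ 32)
    (hK : 2 * (125 / 122) ≤ (459 / 61) * (1 + (125 / 122) * l))
    (hR : (125 / 122) * ((459 / 61) * (R / r₀ - 1) + 4) ≤ (459 / 61) * (1 + (125 / 122) * l)) :
    AffineBelow (expTangent (459 / 61) (125 / 122)) R (P * ((1 + (125 / 122) * l) * (1 - (459 / 61)) + (125 / 122)))
      (P * ((459 / 61) * (1 + (125 / 122) * l) - (125 / 122)) / r₀) :=
  affineBelow_expTangent (n := 61) (m := 459) (by norm_num) (by norm_num) (by norm_num) (by norm_num)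
    hr₀ hP h hl hlr hK hR

/-- Here 963/128 is exactly (15 + 24/512)/2, and 963/128 - 131/128 = 13/2. -/
theorem affineBelow_expTangent128 {P l R r₀ : ℝ} (hr₀ : 0 < r₀) (hP : 0 ≤ P) (h : P ^ 128 ≤ r₀ ^ 963)
    (hl : l ≤ 32) (hlr : r₀ ≤ (1 - l / 32) ^ 32)
    (hK : 2 * (131 / 128) ≤ (963 / 128) * (1 + (131 / 128) * l))
    (hR : (131 / 128) * ((963 / 128) * (R / r₀ - 1) + 4) ≤ (963 / 128) * (1 + (131 / 128) * l)) :
    AffineBelow (expTangent (963 / 128) (131 / 128)) R (P * ((1 + (131 / 128) * l) * (1 - (963 / 128)) + (131 / 128)))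
      (P * ((963 / 128) * (1 + (131 / 128) * l) - (131 / 128)) / r₀) :=
  affineBelow_expTangent (n := 128) (m := 963) (by norm_num) (by norm_num) (by norm_num) (by norm_num)
    hr₀ hP h hl hlr hK hR

/-- Rounds all coefficients down. The two κ terms have opposite signs but combine to 2κ(1 - δ²/4)/(a
+ b), with δ = a - b, which is monotone in κ. -/
theorem near_diagonal_weaken {t T a b E α β κ η μ α' β' κ' η' μ' : ℝ} (hab : InRange a b)
    (hT : tbpEnergy t ≤ T)
    (h : α + β * (a + b) + 2 * κ / (a + b) + (a - b) ^ 2 * (t * (t - 1) / 8 * (η + μ * (a + b))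
      - κ / 2 / (a + b)) ≤ E)
    (hα : α' + T ≤ α) (hβ : β' ≤ β) (hκ : κ' ≤ 2 * κ) (hη : η' ≤ t * (t - 1) / 8 * η)
    (hμ : μ' ≤ t * (t - 1) / 8 * μ) :
    tbpEnergy t + (α' + β' * (a + b) + κ' / (a + b)
      + (a - b) ^ 2 * (η' + μ' * (a + b) - κ' / 4 / (a + b))) ≤ E := by
  obtain ⟨i1, i2, i3, -⟩ := hab
  have hs : 0 < a + b := by linarith
  have hd : (a - b) ^ 2 ≤ 1 := by nlinarith
  have h1 := mul_le_mul_of_nonneg_right hβ hs.le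
  have h2 := mul_le_mul_of_nonneg_left
    (add_le_add hη (mul_le_mul_of_nonneg_right hμ hs.le)) (sq_nonneg (a - b))
  have h3 := mul_le_mul_of_nonneg_right hκ
    (div_nonneg (by linarith : 0 ≤ 1 - (a - b) ^ 2 / 4) hs.le)
  have e3 : ∀ k, k * ((1 - (a - b) ^ 2 / 4) / (a + b))
      = k / (a + b) - (a - b) ^ 2 * (k / 4 / (a + b)) := fun k => by ring
  rw [e3, e3] at h3
  have e4 : (a - b) ^ 2 * (2 * κ / 4 / (a + b)) = (a - b) ^ 2 * (κ / 2 / (a + b)) := by ring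
  linarith

theorem tbpEnergy_459_div_61_le : tbpEnergy (459 / 61) ≤ 3073685767 / 500000000 := by
  have h1 := rpow_le_of_le_pow (Q := 47313541 / 1000000000) (r := 2 / 3) (t := 459 / 61) (m := 459) (n := 61)
    (by norm_num) (by norm_num) (by norm_num) (by norm_num) (by norm_num)
  have h2 := rpow_le_of_le_pow (Q := 5430911 / 1000000000) (r := 1 / 2) (t := 459 / 61) (m := 459) (n := 61)
    (by norm_num) (by norm_num) (by norm_num) (by norm_num) (by norm_num)
  unfold tbpEnergy
  linarith

theorem tbpEnergy_963_div_128_le : tbpEnergy (963 / 128) ≤ 3073721113 / 500000000 := by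
  have h1 := rpow_le_of_le_pow (Q := 23667829 / 500000000) (r := 2 / 3) (t := 963 / 128) (m := 963) (n := 128)
    (by norm_num) (by norm_num) (by norm_num) (by norm_num) (by norm_num)
  have h2 := rpow_le_of_le_pow (Q := 1358813 / 250000000) (r := 1 / 2) (t := 963 / 128) (m := 963) (n := 128)
    (by norm_num) (by norm_num) (by norm_num) (by norm_num) (by norm_num)
  unfold tbpEnergy
  linarith

theorem tbpEnergy_13_div_2_le : tbpEnergy (13 / 2) ≤ 389130807 / 62500000 := by
  have h1 := rpow_le_of_le_pow (Q := 4480091 / 62500000) (r := 2 / 3) (t := 13 / 2) (m := 13) (n := 2)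
    (by norm_num) (by norm_num) (by norm_num) (by norm_num) (by norm_num)
  have h2 := rpow_le_of_le_pow (Q := 345267 / 31250000) (r := 1 / 2) (t := 13 / 2) (m := 13) (n := 2)
    (by norm_num) (by norm_num) (by norm_num) (by norm_num) (by norm_num)
  unfold tbpEnergy
  linarith

theorem tbpEnergy_le_of_eq_13_div_2 {t : ℝ} (ht : t = 13 / 2) : tbpEnergy t ≤ 389130807 / 62500000 := by
  rw [ht]
  exact tbpEnergy_13_div_2_le

/-! ### Upper exponent away from the diagonal -/

/-- In this and the similar strips, (a₀, b₀) is a base point with a₀ - b₀ inside the strip. Each r₀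
is approximately the corresponding r there, P is a lower approximation of r₀^t, and α, β, γ are
rounded down. -/
theorem upper_exponent_bound_19_25 {a b : ℝ} (hab : InRange a b) (h0 : (19 / 100) ≤ a - b)
    (h1 : a - b ≤ (1 / 4)) :
    tbpEnergy (459 / 61) < pyramidEnergy (fun r => r ^ (459 / 61 : ℝ)) a b :=
  tbpEnergy_459_div_61_le.trans_lt <| pyramidEnergy_gt_of_tangents (859 / 1000) (629 / 1000) (19 / 100) (1 / 4) _ hab h0 h1
    (affineBelow_rpow61 (P := 288442803 / 500000000) (r₀ := 1859 / 2000) (by norm_num) (by norm_num) (by norm_num))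
    (affineBelow_rpow61 (P := 13346641 / 62500000) (r₀ := 1629 / 2000) (by norm_num) (by norm_num) (by norm_num))
    (affineBelow_rpow61 (P := 2836231 / 500000000) (r₀ := 5029 / 10000) (by norm_num) (by norm_num) (by norm_num))
    (affineBelow_rpow61 (P := 1014211 / 125000000) (r₀ := 2637 / 5000) (by norm_num) (by norm_num) (by norm_num))
    (affineBelow_rpow61 (P := 570144007 / 500000000) (r₀ := 636 / 625) (by norm_num) (by norm_num) (by norm_num))
    (by norm_num) (by norm_num) (by norm_num) (by norm_num) (by norm_num)
    (α := -5671029 / 250000) (β := 2333149 / 500000) (γ := 1950699 / 1000000)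
    (by norm_num) (by norm_num) (by norm_num) (by norm_num) (by norm_num) (by norm_num)

theorem upper_exponent_bound_25_32 {a b : ℝ} (hab : InRange a b) (h0 : (1 / 4) ≤ a - b)
    (h1 : a - b ≤ (8 / 25)) :
    tbpEnergy (459 / 61) < pyramidEnergy (fun r => r ^ (459 / 61 : ℝ)) a b :=
  tbpEnergy_459_div_61_le.trans_lt <| pyramidEnergy_gt_of_tangents (441 / 500) (74 / 125) (1 / 4) (8 / 25) _ hab h0 h1
    (affineBelow_rpow61 (P := 126561827 / 200000000) (r₀ := 941 / 1000) (by norm_num) (by norm_num) (by norm_num))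
    (affineBelow_rpow61 (P := 179643473 / 1000000000) (r₀ := 199 / 250) (by norm_num) (by norm_num) (by norm_num))
    (affineBelow_rpow61 (P := 139913 / 25000000) (r₀ := 251 / 500) (by norm_num) (by norm_num) (by norm_num))
    (affineBelow_rpow61 (P := 452433 / 50000000) (r₀ := 5351 / 10000) (by norm_num) (by norm_num) (by norm_num))
    (affineBelow_rpow61 (P := 1129372249 / 1000000000) (r₀ := 10163 / 10000) (by norm_num) (by norm_num) (by norm_num))
    (by norm_num) (by norm_num) (by norm_num) (by norm_num) (by norm_num)
    (α := -22707353 / 1000000) (β := 2528593 / 500000) (γ := 1668691 / 1000000)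
    (by norm_num) (by norm_num) (by norm_num) (by norm_num) (by norm_num) (by norm_num)

theorem upper_exponent_bound_32_40 {a b : ℝ} (hab : InRange a b) (h0 : (8 / 25) ≤ a - b)
    (h1 : a - b ≤ (2 / 5)) :
    tbpEnergy (459 / 61) < pyramidEnergy (fun r => r ^ (459 / 61 : ℝ)) a b :=
  tbpEnergy_459_div_61_le.trans_lt <| pyramidEnergy_gt_of_tangents (91 / 100) (27 / 50) (8 / 25) (2 / 5) _ hab h0 h1
    (affineBelow_rpow61 (P := 11049779 / 15625000) (r₀ := 191 / 200) (by norm_num) (by norm_num) (by norm_num))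
    (affineBelow_rpow61 (P := 69961519 / 500000000) (r₀ := 77 / 100) (by norm_num) (by norm_num) (by norm_num))
    (affineBelow_rpow61 (P := 2760731 / 500000000) (r₀ := 5011 / 10000) (by norm_num) (by norm_num) (by norm_num))
    (affineBelow_rpow61 (P := 5487299 / 500000000) (r₀ := 549 / 1000) (by norm_num) (by norm_num) (by norm_num))
    (affineBelow_rpow61 (P := 278188923 / 250000000) (r₀ := 10143 / 10000) (by norm_num) (by norm_num) (by norm_num))
    (by norm_num) (by norm_num) (by norm_num) (by norm_num) (by norm_num)
    (α := -11375041 / 500000) (β := 5569873 / 1000000) (γ := 1321677 / 1000000)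
    (by norm_num) (by norm_num) (by norm_num) (by norm_num) (by norm_num) (by norm_num)

theorem upper_exponent_bound_40_48 {a b : ℝ} (hab : InRange a b) (h0 : (2 / 5) ≤ a - b)
    (h1 : a - b ≤ (97 / 200)) :
    tbpEnergy (459 / 61) < pyramidEnergy (fun r => r ^ (459 / 61 : ℝ)) a b :=
  tbpEnergy_459_div_61_le.trans_lt <| pyramidEnergy_gt_of_tangents (939 / 1000) (479 / 1000) (2 / 5) (97 / 200) _ hab h0 h1
    (affineBelow_rpow61 (P := 792095979 / 1000000000) (r₀ := 1939 / 2000) (by norm_num) (by norm_num) (by norm_num))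
    (affineBelow_rpow61 (P := 103231801 / 1000000000) (r₀ := 1479 / 2000) (by norm_num) (by norm_num) (by norm_num))
    (affineBelow_rpow61 (P := 5471909 / 1000000000) (r₀ := 1001 / 2000) (by norm_num) (by norm_num) (by norm_num))
    (affineBelow_rpow61 (P := 735549 / 50000000) (r₀ := 1427 / 2500) (by norm_num) (by norm_num) (by norm_num))
    (affineBelow_rpow61 (P := 13592737 / 12500000) (r₀ := 632 / 625) (by norm_num) (by norm_num) (by norm_num))
    (by norm_num) (by norm_num) (by norm_num) (by norm_num) (by norm_num)
    (α := -11384209 / 500000) (β := 6146323 / 1000000) (γ := 242249 / 250000)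
    (by norm_num) (by norm_num) (by norm_num) (by norm_num) (by norm_num) (by norm_num)

/-! ### Tangent in the exponent, extrapolated to 13/2 -/

theorem extrapolated_bound_00_13 {a b : ℝ} (hab : InRange a b) (h0 : 0 ≤ a - b)
    (h1 : a - b ≤ (13 / 100)) :
    tbpEnergy (459 / 61 - 125 / 122) < pyramidEnergy (expTangent (459 / 61) (125 / 122)) a b :=
  (tbpEnergy_le_of_eq_13_div_2 (by norm_num)).trans_lt <| pyramidEnergy_gt_of_tangents (769 / 1000) (709 / 1000) 0 (13 / 100) _ hab h0 h1
    (affineBelow_expTangent61 (P := 198560599 / 500000000) (l := 61 / 500) (r₀ := 1769 / 2000) (by norm_num)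
      (by norm_num) (by norm_num) (by norm_num) (by norm_num) (by norm_num) (by norm_num))
    (affineBelow_expTangent61 (P := 306310081 / 1000000000) (l := 39 / 250) (r₀ := 1709 / 2000) (by norm_num)
      (by norm_num) (by norm_num) (by norm_num) (by norm_num) (by norm_num) (by norm_num))
    (affineBelow_expTangent61 (P := 6183649 / 1000000000) (l := 167 / 250) (r₀ := 5087 / 10000) (by norm_num)
      (by norm_num) (by norm_num) (by norm_num) (by norm_num) (by norm_num) (by norm_num))
    (affineBelow_expTangent61 (P := 423363 / 62500000) (l := 82 / 125) (r₀ := 5149 / 10000) (by norm_num)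
      (by norm_num) (by norm_num) (by norm_num) (by norm_num) (by norm_num) (by norm_num))
    (affineBelow_expTangent61 (P := 295999951 / 250000000) (l := -23 / 1000) (r₀ := 10227 / 10000) (by norm_num)
      (by norm_num) (by norm_num) (by norm_num) (by norm_num) (by norm_num) (by norm_num))
    (by norm_num) (by norm_num) (by norm_num) (by norm_num) (by norm_num)
    (α := -19784211 / 1000000) (β := 1664211 / 500000) (γ := 2742361 / 1000000)
    (by norm_num) (by norm_num) (by norm_num) (by norm_num) (by norm_num) (by norm_num)

theorem extrapolated_bound_13_28 {a b : ℝ} (hab : InRange a b) (h0 : (13 / 100) ≤ a - b)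
    (h1 : a - b ≤ (7 / 25)) :
    tbpEnergy (459 / 61 - 125 / 122) < pyramidEnergy (expTangent (459 / 61) (125 / 122)) a b :=
  (tbpEnergy_le_of_eq_13_div_2 (by norm_num)).trans_lt <| pyramidEnergy_gt_of_tangents (104 / 125) (79 / 125) (13 / 100) (7 / 25) _ hab h0 h1
    (affineBelow_expTangent61 (P := 516748299 / 1000000000) (l := 87 / 1000) (r₀ := 229 / 250) (by norm_num)
      (by norm_num) (by norm_num) (by norm_num) (by norm_num) (by norm_num) (by norm_num))
    (affineBelow_expTangent61 (P := 216523299 / 1000000000) (l := 101 / 500) (r₀ := 102 / 125) (by norm_num)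
      (by norm_num) (by norm_num) (by norm_num) (by norm_num) (by norm_num) (by norm_num))
    (affineBelow_expTangent61 (P := 5783733 / 1000000000) (l := 677 / 1000) (r₀ := 2521 / 5000) (by norm_num)
      (by norm_num) (by norm_num) (by norm_num) (by norm_num) (by norm_num) (by norm_num))
    (affineBelow_expTangent61 (P := 8044489 / 1000000000) (l := 317 / 500) (r₀ := 1317 / 2500) (by norm_num)
      (by norm_num) (by norm_num) (by norm_num) (by norm_num) (by norm_num) (by norm_num))
    (affineBelow_expTangent61 (P := 1170132553 / 1000000000) (l := -21 / 1000) (r₀ := 10211 / 10000) (by norm_num)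
      (by norm_num) (by norm_num) (by norm_num) (by norm_num) (by norm_num) (by norm_num))
    (by norm_num) (by norm_num) (by norm_num) (by norm_num) (by norm_num)
    (α := -3960849 / 200000) (β := 4037797 / 1000000) (γ := 526327 / 250000)
    (by norm_num) (by norm_num) (by norm_num) (by norm_num) (by norm_num) (by norm_num)

theorem extrapolated_bound_28_39 {a b : ℝ} (hab : InRange a b) (h0 : (7 / 25) ≤ a - b)
    (h1 : a - b ≤ (39 / 100)) :
    tbpEnergy (459 / 61 - 125 / 122) < pyramidEnergy (expTangent (459 / 61) (125 / 122)) a b :=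
  (tbpEnergy_le_of_eq_13_div_2 (by norm_num)).trans_lt <| pyramidEnergy_gt_of_tangents (111 / 125) (137 / 250) (7 / 25) (39 / 100) _ hab h0 h1
    (affineBelow_expTangent61 (P := 648148491 / 1000000000) (l := 57 / 1000) (r₀ := 118 / 125) (by norm_num)
      (by norm_num) (by norm_num) (by norm_num) (by norm_num) (by norm_num) (by norm_num))
    (affineBelow_expTangent61 (P := 145486041 / 1000000000) (l := 51 / 200) (r₀ := 387 / 500) (by norm_num)
      (by norm_num) (by norm_num) (by norm_num) (by norm_num) (by norm_num) (by norm_num))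
    (affineBelow_expTangent61 (P := 1115953 / 200000000) (l := 341 / 500) (r₀ := 2509 / 5000) (by norm_num)
      (by norm_num) (by norm_num) (by norm_num) (by norm_num) (by norm_num) (by norm_num))
    (affineBelow_expTangent61 (P := 5309351 / 500000000) (l := 299 / 500) (r₀ := 2733 / 5000) (by norm_num)
      (by norm_num) (by norm_num) (by norm_num) (by norm_num) (by norm_num) (by norm_num))
    (affineBelow_expTangent61 (P := 570144007 / 500000000) (l := -9 / 500) (r₀ := 636 / 625) (by norm_num)
      (by norm_num) (by norm_num) (by norm_num) (by norm_num) (by norm_num) (by norm_num))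
    (by norm_num) (by norm_num) (by norm_num) (by norm_num) (by norm_num)
    (α := -19806313 / 1000000) (β := 1190057 / 250000) (γ := 1528453 / 1000000)
    (by norm_num) (by norm_num) (by norm_num) (by norm_num) (by norm_num) (by norm_num)

theorem extrapolated_bound_39_44 {a b : ℝ} (hab : InRange a b) (h0 : (39 / 100) ≤ a - b)
    (h1 : a - b ≤ (11 / 25)) :
    tbpEnergy (459 / 61 - 125 / 122) < pyramidEnergy (expTangent (459 / 61) (125 / 122)) a b :=
  (tbpEnergy_le_of_eq_13_div_2 (by norm_num)).trans_lt <| pyramidEnergy_gt_of_tangents (921 / 1000) (491 / 1000) (39 / 100) (11 / 25) _ hab h0 h1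
    (affineBelow_expTangent61 (P := 369206961 / 500000000) (l := 1 / 25) (r₀ := 1921 / 2000) (by norm_num)
      (by norm_num) (by norm_num) (by norm_num) (by norm_num) (by norm_num) (by norm_num))
    (affineBelow_expTangent61 (P := 54851793 / 500000000) (l := 73 / 250) (r₀ := 1491 / 2000) (by norm_num)
      (by norm_num) (by norm_num) (by norm_num) (by norm_num) (by norm_num) (by norm_num))
    (affineBelow_expTangent61 (P := 5496637 / 1000000000) (l := 171 / 250) (r₀ := 313 / 625) (by norm_num)
      (by norm_num) (by norm_num) (by norm_num) (by norm_num) (by norm_num) (by norm_num))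
    (affineBelow_expTangent61 (P := 13805271 / 1000000000) (l := 141 / 250) (r₀ := 283 / 500) (by norm_num)
      (by norm_num) (by norm_num) (by norm_num) (by norm_num) (by norm_num) (by norm_num))
    (affineBelow_expTangent61 (P := 1111930459 / 1000000000) (l := -3 / 200) (r₀ := 5071 / 5000) (by norm_num)
      (by norm_num) (by norm_num) (by norm_num) (by norm_num) (by norm_num) (by norm_num))
    (by norm_num) (by norm_num) (by norm_num) (by norm_num) (by norm_num)
    (α := -9894539 / 500000) (β := 1046253 / 200000) (γ := 1183659 / 1000000)
    (by norm_num) (by norm_num) (by norm_num) (by norm_num) (by norm_num) (by norm_num)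

theorem extrapolated_bound_44_48 {a b : ℝ} (hab : InRange a b) (h0 : (11 / 25) ≤ a - b)
    (h1 : a - b ≤ (97 / 200)) :
    tbpEnergy (459 / 61 - 125 / 122) < pyramidEnergy (expTangent (459 / 61) (125 / 122)) a b :=
  (tbpEnergy_le_of_eq_13_div_2 (by norm_num)).trans_lt <| pyramidEnergy_gt_of_tangents (117 / 125) (461 / 1000) (11 / 25) (97 / 200) _ hab h0 h1
    (affineBelow_expTangent61 (P := 391460419 / 500000000) (l := 4 / 125) (r₀ := 121 / 125) (by norm_num)
      (by norm_num) (by norm_num) (by norm_num) (by norm_num) (by norm_num) (by norm_num))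
    (affineBelow_expTangent61 (P := 94145171 / 1000000000) (l := 39 / 125) (r₀ := 1461 / 2000) (by norm_num)
      (by norm_num) (by norm_num) (by norm_num) (by norm_num) (by norm_num) (by norm_num))
    (affineBelow_expTangent61 (P := 5471909 / 1000000000) (l := 171 / 250) (r₀ := 1001 / 2000) (by norm_num)
      (by norm_num) (by norm_num) (by norm_num) (by norm_num) (by norm_num) (by norm_num))
    (affineBelow_expTangent61 (P := 16335199 / 1000000000) (l := 271 / 500) (r₀ := 1447 / 2500) (by norm_num)
      (by norm_num) (by norm_num) (by norm_num) (by norm_num) (by norm_num) (by norm_num))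
    (affineBelow_expTangent61 (P := 54817577 / 50000000) (l := -13 / 1000) (r₀ := 10123 / 10000) (by norm_num)
      (by norm_num) (by norm_num) (by norm_num) (by norm_num) (by norm_num) (by norm_num))
    (by norm_num) (by norm_num) (by norm_num) (by norm_num) (by norm_num)
    (α := -4943043 / 250000) (β := 2727239 / 500000) (γ := 252029 / 250000)
    (by norm_num) (by norm_num) (by norm_num) (by norm_num) (by norm_num) (by norm_num)

theorem extrapolated_bound_square {a b : ℝ} (hab : InRange a b) (h0 : 0 ≤ a - b)
    (h1 : a - b ≤ (3 / 100)) :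
    tbpEnergy (963 / 128 - 131 / 128) < pyramidEnergy (expTangent (963 / 128) (131 / 128)) a b :=
  (tbpEnergy_le_of_eq_13_div_2 (by norm_num)).trans_lt <| pyramidEnergy_gt_of_tangents (37 / 50) (37 / 50) 0 (3 / 100) _ hab h0 h1
    (affineBelow_expTangent128 (P := 350733199 / 1000000000) (l := 69 / 500) (r₀ := 87 / 100) (by norm_num)
      (by norm_num) (by norm_num) (by norm_num) (by norm_num) (by norm_num) (by norm_num))
    (affineBelow_expTangent128 (P := 350733199 / 1000000000) (l := 69 / 500) (r₀ := 87 / 100) (by norm_num)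
      (by norm_num) (by norm_num) (by norm_num) (by norm_num) (by norm_num) (by norm_num))
    (affineBelow_expTangent128 (P := 1287981 / 200000000) (l := 663 / 1000) (r₀ := 2557 / 5000) (by norm_num)
      (by norm_num) (by norm_num) (by norm_num) (by norm_num) (by norm_num) (by norm_num))
    (affineBelow_expTangent128 (P := 1287981 / 200000000) (l := 663 / 1000) (r₀ := 2557 / 5000) (by norm_num)
      (by norm_num) (by norm_num) (by norm_num) (by norm_num) (by norm_num) (by norm_num))
    (affineBelow_expTangent128 (P := 118484043 / 100000000) (l := -23 / 1000) (r₀ := 2557 / 2500) (by norm_num)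
      (by norm_num) (by norm_num) (by norm_num) (by norm_num) (by norm_num) (by norm_num))
    (by norm_num) (by norm_num) (by norm_num) (by norm_num) (by norm_num)
    (α := -19782731 / 1000000) (β := 1516847 / 500000) (γ := 1516847 / 500000)
    (by norm_num) (by norm_num) (by norm_num) (by norm_num) (by norm_num) (by norm_num)

/-! ### Second-order bounds near the diagonal -/

theorem near_diagonal_963_div_128 {a b : ℝ} (hab : InRange a b) :
    tbpEnergy (963 / 128) + ((-2261672253 / 100000000) + (374157877 / 50000000) * (a + b) + (170889591 / 10000000) / (a + b)
      + (a - b) ^ 2 * ((-2060197 / 500000) + (1175691 / 250000) * (a + b) - (170889591 / 10000000) / 4 / (a + b)))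
      ≤ pyramidEnergy (fun r => r ^ (963 / 128 : ℝ)) a b := by
  have h := pyramidEnergy_rpow_ge (t := 963 / 128) (7559 / 10000) hab (by norm_num)
    (affineBelow_rpow (P := 375737483 / 1000000000) (r₀ := 439 / 500) (n := 128) (m := 963) (by norm_num)
      (by norm_num) (by norm_num) (by norm_num) (by norm_num) (by norm_num))
    (affineBelow_rpow (P := 30463199 / 62500000) (r₀ := 439 / 500) (n := 128) (m := 707) (by norm_num)
      (by norm_num) (by norm_num) (by norm_num) (by norm_num) (by norm_num))
    (affineBelow_rpow (P := 6299147 / 1000000000) (r₀ := 5099 / 10000) (n := 128) (m := 963) (by norm_num)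
      (by norm_num) (by norm_num) (by norm_num) (by norm_num) (by norm_num))
    (affineBelow_rpow (P := 579044207 / 500000000) (r₀ := 10197 / 10000) (n := 128) (m := 963) (by norm_num)
      (by norm_num) (by norm_num) (by norm_num) (by norm_num) (by norm_num))
    (by norm_num) (by norm_num)
  exact near_diagonal_weaken hab tbpEnergy_963_div_128_le h (by norm_num) (by norm_num) (by norm_num) (by norm_num)
    (by norm_num)

theorem near_diagonal_459_div_61 {a b : ℝ} (hab : InRange a b) :
    tbpEnergy (459 / 61) + ((-70687377 / 3125000) + (374197293 / 50000000) * (a + b) + (427299041 / 25000000) / (a + b)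
      + (a - b) ^ 2 * ((-206131 / 50000) + (294037 / 62500) * (a + b) - (427299041 / 25000000) / 4 / (a + b)))
      ≤ pyramidEnergy (fun r => r ^ (459 / 61 : ℝ)) a b := by
  have h := pyramidEnergy_rpow_ge (t := 459 / 61) (7561 / 10000) hab (by norm_num)
    (affineBelow_rpow (P := 375681137 / 1000000000) (r₀ := 439 / 500) (n := 61) (m := 459) (by norm_num)
      (by norm_num) (by norm_num) (by norm_num) (by norm_num) (by norm_num))
    (affineBelow_rpow (P := 487338091 / 1000000000) (r₀ := 439 / 500) (n := 61) (m := 337) (by norm_num)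
      (by norm_num) (by norm_num) (by norm_num) (by norm_num) (by norm_num))
    (affineBelow_rpow (P := 392811 / 62500000) (r₀ := 2549 / 5000) (n := 61) (m := 459) (by norm_num)
      (by norm_num) (by norm_num) (by norm_num) (by norm_num) (by norm_num))
    (affineBelow_rpow (P := 144764307 / 125000000) (r₀ := 10197 / 10000) (n := 61) (m := 459) (by norm_num)
      (by norm_num) (by norm_num) (by norm_num) (by norm_num) (by norm_num))
    (by norm_num) (by norm_num)
  exact near_diagonal_weaken hab tbpEnergy_459_div_61_le h (by norm_num) (by norm_num) (by norm_num) (by norm_num)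
    (by norm_num)

/-! ### The energy bound in terms of `(a, b)` -/

theorem extrapolated_bound {a b : ℝ} (hab : InRange a b) :
    tbpEnergy (459 / 61 - 125 / 122) < pyramidEnergy (expTangent (459 / 61) (125 / 122)) a b := by
  have h0 := hab.le
  have h1 := hab.sub_le
  rcases le_total (a - b) (13 / 100) with i1 | i1
  · exact extrapolated_bound_00_13 hab (by linarith) i1
  rcases le_total (a - b) (7 / 25) with i2 | i2
  · exact extrapolated_bound_13_28 hab i1 i2
  rcases le_total (a - b) (39 / 100) with i3 | i3
  · exact extrapolated_bound_28_39 hab i2 i3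
  rcases le_total (a - b) (11 / 25) with i4 | i4
  · exact extrapolated_bound_39_44 hab i3 i4
  · exact extrapolated_bound_44_48 hab i4 h1

theorem upper_exponent_bound_far {a b : ℝ} (hab : InRange a b) (h0 : 19 / 100 ≤ a - b) :
    tbpEnergy (459 / 61) < pyramidEnergy (fun r => r ^ (459 / 61 : ℝ)) a b := by
  have h1 := hab.sub_le
  rcases le_total (a - b) (1 / 4) with i1 | i1
  · exact upper_exponent_bound_19_25 hab h0 i1
  rcases le_total (a - b) (8 / 25) with i2 | i2
  · exact upper_exponent_bound_25_32 hab i1 i2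
  rcases le_total (a - b) (2 / 5) with i3 | i3
  · exact upper_exponent_bound_32_40 hab i2 i3
  · exact upper_exponent_bound_40_48 hab i3 h1

theorem near_form_pos {α β κ η μ σ d : ℝ} (hσ : 0 < σ)
    (h : 0 < β * σ ^ 2 + α * σ + κ + d * (μ * σ ^ 2 + η * σ - κ / 4)) :
    0 < α + β * σ + κ / σ + d * (η + μ * σ - κ / 4 / σ) := by
  have e : α + β * σ + κ / σ + d * (η + μ * σ - κ / 4 / σ)
      = (β * σ ^ 2 + α * σ + κ + d * (μ * σ ^ 2 + η * σ - κ / 4)) / σ := by field_simp; ring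
  rw [e]
  exact div_pos h hσ

theorem pos_of_affine {q k d d₁ : ℝ} (h0 : 0 ≤ d) (h1 : d ≤ d₁) (p0 : 0 < q)
    (p1 : 0 < q + d₁ * k) : 0 < q + d * k := by
  rcases le_total 0 k with hk | hk
  · linarith [mul_nonneg h0 hk]
  · linarith [mul_le_mul_of_nonpos_right h1 hk]

theorem upper_exponent_bound_near {a b : ℝ} (hab : InRange a b) (h1 : a - b ≤ 19 / 100)
    (h : (7 / 8) ^ 2 ≤ a ∨ b ≤ (55 / 64) ^ 2) :
    tbpEnergy (459 / 61) < pyramidEnergy (fun r => r ^ (459 / 61 : ℝ)) a b := by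
  have key := near_diagonal_459_div_61 hab
  obtain ⟨i1, i2, i3, -⟩ := hab
  refine lt_of_lt_of_le (lt_add_of_pos_right _ (near_form_pos (by linarith) ?_)) key
  obtain ⟨σ, hσ⟩ : ∃ σ, σ = a + b := ⟨_, rfl⟩
  obtain ⟨δ, hδ⟩ : ∃ δ, δ = a - b := ⟨_, rfl⟩
  rw [← hσ, ← hδ]
  have hδ0 : 0 ≤ δ := by linarith
  have hδ1 : δ ≤ 19 / 100 := by linarith
  have hd : δ ^ 2 ≤ 1 / 25 := by nlinarith
  have h' : (49 / 32 : ℝ) ≤ σ + δ ∨ σ - δ ≤ (3025 / 2048 : ℝ) := by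
    rcases h with h | h
    · left; norm_num at h; linarith
    · right; norm_num at h; linarith
  -- The quadratic at δ = 0 is slightly negative near its minimiser σ ≈ 1.511; its deficit is less
  -- than 1/20000.
  have q0 := quadratic_pos_of_discrim_neg (A := 374197293 / 50000000) (B := -70687377 / 3125000)
    (C := 427299041 / 25000000 + 1 / 20000) (x := σ) (by norm_num) (by norm_num)
  -- Left of 3/2 the coefficient of δ² may be negative, but the δ = 0 quadratic is already positive.
  -- Right of 3/2 that coefficient is at least 0.128.
  rcases le_total σ (3 / 2) with h3 | h3
  · refine pos_of_affine (d₁ := 1 / 25) (sq_nonneg δ) hd (by nlinarith) ?_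
    have := quadratic_pos_of_discrim_neg
      (A := 374197293 / 50000000 + 1 / 25 * (294037 / 62500))
      (B := -70687377 / 3125000 + 1 / 25 * (-206131 / 50000))
      (C := 427299041 / 25000000 - 1 / 25 * (427299041 / 25000000) / 4) (x := σ) (by norm_num)
      (by norm_num)
    linarith
  have hk : 128 / 1000 + 9 * (σ - 3 / 2) ≤ (294037 / 62500) * σ ^ 2 + (-206131 / 50000) * σ
      - (427299041 / 25000000) / 4 := by nlinarith
  have hk0 : 128 / 1000 ≤ (294037 / 62500) * σ ^ 2 + (-206131 / 50000) * σ
      - (427299041 / 25000000) / 4 := by linarith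
  rcases h' with h' | h'
  · rcases le_total (38 / 25) σ with h4 | h4
    · have : 0 < (374197293 / 50000000) * σ ^ 2 + (-70687377 / 3125000) * σ
        + 427299041 / 25000000 := by nlinarith
      linarith [mul_nonneg (sq_nonneg δ) ((by norm_num : (0 : ℝ) ≤ 128 / 1000).trans hk0)]
    -- Here δ ≥ 49/32 - σ. The square is replaced by its tangent at 0.0213, close to 49/32 - σ for σ
    -- near the minimiser.
    · have hl : 2 * (213 / 10000) * (49 / 32 - σ) - (213 / 10000) ^ 2 ≤ δ ^ 2 := by
        nlinarith [sq_nonneg (δ - 213 / 10000)]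
      have hl0 : 0 ≤ 2 * (213 / 10000) * (49 / 32 - σ) - (213 / 10000) ^ 2 := by
        norm_num; linarith
      have := mul_le_mul hl hk (by linarith) (sq_nonneg δ)
      nlinarith [sq_nonneg (σ - 1512 / 1000)]
  -- Here δ ≥ 3/2 - 3025/2048, and 0.00052 · 0.128 exceeds 1/20000.
  · have hd0 : 52 / 100000 ≤ δ ^ 2 := by nlinarith
    have := mul_le_mul hd0 hk0 (by norm_num) (sq_nonneg δ)
    linarith

theorem upper_exponent_bound_square {a b : ℝ} (hab : InRange a b) (h1 : a - b ≤ 3 / 100) :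
    tbpEnergy (963 / 128) < pyramidEnergy (fun r => r ^ (963 / 128 : ℝ)) a b := by
  have key := near_diagonal_963_div_128 hab
  obtain ⟨i1, i2, i3, -⟩ := hab
  refine lt_of_lt_of_le (lt_add_of_pos_right _ (near_form_pos (by linarith) ?_)) key
  have hd : (a - b) ^ 2 ≤ 1 / 1000 := by nlinarith
  have q0 := quadratic_pos_of_discrim_neg (A := 374157877 / 50000000) (B := -2261672253 / 100000000)
    (C := 170889591 / 10000000) (x := a + b) (by norm_num) (by norm_num)
  have q1 := quadratic_pos_of_discrim_neg (A := 374157877 / 50000000 + 1 / 1000 * (1175691 / 250000))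
    (B := -2261672253 / 100000000 + 1 / 1000 * (-2060197 / 500000))
    (C := 170889591 / 10000000 - 1 / 1000 * (170889591 / 10000000) / 4) (x := a + b) (by norm_num)
    (by norm_num)
  exact pos_of_affine (d₁ := 1 / 1000) (sq_nonneg _) hd q0 (by linarith)

/-- The configurations in the exceptional square. -/
theorem tbpEnergy_lt_of_square {t a b : ℝ} (hab : InRange a b) (h1 : a - b ≤ 3 / 100)
    (ht : t ∈ Icc (13 / 2 : ℝ) (963 / 128)) :
    tbpEnergy t < pyramidEnergy (fun r => r ^ t) a b :=
  tbpEnergy_lt_of_interp hab (τ := 131 / 128) (by norm_num) (by norm_num; exact ht.1) ht.2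
    (upper_exponent_bound_square hab h1) (extrapolated_bound_square hab (by linarith [hab.le]) h1)

/-- The configurations outside of the exceptional square. -/
theorem tbpEnergy_lt_of_not_square {t a b : ℝ} (hab : InRange a b)
    (h : (7 / 8) ^ 2 ≤ a ∨ b ≤ (55 / 64) ^ 2) (ht : t ∈ Icc (13 / 2 : ℝ) (459 / 61)) :
    tbpEnergy t < pyramidEnergy (fun r => r ^ t) a b := by
  refine tbpEnergy_lt_of_interp hab (τ := 125 / 122) (by norm_num) (by norm_num; exact ht.1) ht.2
    ?_ (extrapolated_bound hab)
  rcases le_total (a - b) (19 / 100) with h1 | h1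
  · exact upper_exponent_bound_near hab h1 h
  · exact upper_exponent_bound_far hab h1

/-! ### Energies of configurations -/

/-- The symmetric sum over ordered pairs is visibly invariant under relabelling. -/
theorem two_mul_energy (f : ℝ → ℝ) (X : Configuration) :
    2 * energy f X = ∑ i : Fin 5, ∑ j : Fin 5,
      if i = j then 0 else f (dist (X.point i) (X.point j)) := by
  have h : ∀ i j, ‖X.point i - X.point j‖ = dist (X.point i) (X.point j) :=
    fun i j => (dist_eq_norm _ _).symm
  have e : energy f X = ∑ i : Fin 5, ∑ j : Fin 5,
      if i < j then f (dist (X.point i) (X.point j)) else 0 := by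
    unfold energy
    refine Finset.sum_congr rfl fun i _ => ?_
    rw [← Finset.sum_filter]
    refine Finset.sum_congr ?_ fun j _ => by rw [h]
    ext j; simp
  rw [two_mul]
  nth_rewrite 1 [e]
  rw [e.trans Finset.sum_comm, ← Finset.sum_add_distrib]
  refine Finset.sum_congr rfl fun i _ => ?_
  rw [← Finset.sum_add_distrib]
  refine Finset.sum_congr rfl fun j _ => ?_
  rcases lt_trichotomy i j with hij | rfl | hij
  · simp [hij, hij.ne, hij.not_gt]
  · simp
  · simp [hij, hij.ne', hij.not_gt, dist_comm]

theorem energy_eq_of_isometric (f : ℝ → ℝ) {X Y : Configuration} (h : X.Isometric Y) :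
    energy f X = energy f Y := by
  obtain ⟨σ, hσ⟩ := h
  have h2 : 2 * energy f X = 2 * energy f Y := by
    rw [two_mul_energy, two_mul_energy, ← Equiv.sum_comp σ]
    refine Finset.sum_congr rfl fun i _ => ?_
    rw [← Equiv.sum_comp σ]
    refine Finset.sum_congr rfl fun j _ => ?_
    simp only [hσ, σ.injective.eq_iff]
  linarith

theorem energy_eq_sum (f : ℝ → ℝ) (X : Configuration) :
    energy f X = f ‖X.point 0 - X.point 1‖ + f ‖X.point 0 - X.point 2‖ + f ‖X.point 0 - X.point 3‖
      + f ‖X.point 0 - X.point 4‖ + f ‖X.point 1 - X.point 2‖ + f ‖X.point 1 - X.point 3‖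
      + f ‖X.point 1 - X.point 4‖ + f ‖X.point 2 - X.point 3‖ + f ‖X.point 2 - X.point 4‖
      + f ‖X.point 3 - X.point 4‖ := by
  have e0 : Finset.Ioi (0 : Fin 5) = {1, 2, 3, 4} := by decide
  have e1 : Finset.Ioi (1 : Fin 5) = {2, 3, 4} := by decide
  have e2 : Finset.Ioi (2 : Fin 5) = {3, 4} := by decide
  have e3 : Finset.Ioi (3 : Fin 5) = {4} := by decide
  have e4 : Finset.Ioi (4 : Fin 5) = ∅ := by decide
  simp only [energy, Fin.sum_univ_five, e0, e1, e2, e3, e4]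
  simp
  ring

theorem rpow_mul_riesz {t r q : ℝ} (ht : 0 < t) (hr : 0 ≤ r) (hq : 0 < q) (h : r ^ 2 = 2 / q) :
    2 ^ t * riesz (2 * t) r = q ^ t := by
  have h2 : r ^ (-(2 * t)) = (2 / q) ^ (-t) := by
    rw [← h, ← Real.rpow_natCast, ← Real.rpow_mul hr]; congr 1; push_cast; ring
  rw [riesz, Real.sign_of_pos (by linarith), one_mul, h2, Real.rpow_neg (by positivity),
    Real.div_rpow (by norm_num) hq.le, inv_div]
  have : (2 : ℝ) ^ t ≠ 0 := (Real.rpow_pos_of_pos (by norm_num) t).ne'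
  field_simp

theorem norm_sub_sq_E3 (v w : E3) :
    ‖v - w‖ ^ 2 = (v 0 - w 0) ^ 2 + (v 1 - w 1) ^ 2 + (v 2 - w 2) ^ 2 := by
  simp [EuclideanSpace.norm_sq_eq, Fin.sum_univ_three]

theorem rpow_mul_energy_TBP {t : ℝ} (ht : 0 < t) :
    2 ^ t * energy (riesz (2 * t)) TBP = tbpEnergy t := by
  have h3 : (√3 : ℝ) ^ 2 = 3 := Real.sq_sqrt (by norm_num)
  have key : ∀ i j : Fin 5, ∀ q : ℝ, 0 < q → ‖tbpPoint i - tbpPoint j‖ ^ 2 = 2 / q →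
      2 ^ t * riesz (2 * t) ‖TBP.point i - TBP.point j‖ = q ^ t := fun i j q hq h =>
    rpow_mul_riesz ht (norm_nonneg _) hq h
  rw [energy_eq_sum]
  simp only [mul_add]
  rw [key 0 1 (1 / 2) (by norm_num) (by rw [norm_sub_sq_E3]; simp [tbpPoint]; norm_num),
    key 0 2 1 (by norm_num) (by rw [norm_sub_sq_E3]; simp [tbpPoint]; norm_num),
    key 0 3 1 (by norm_num) (by rw [norm_sub_sq_E3]; simp [tbpPoint]; nlinarith),
    key 0 4 1 (by norm_num) (by rw [norm_sub_sq_E3]; simp [tbpPoint]; nlinarith),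
    key 1 2 1 (by norm_num) (by rw [norm_sub_sq_E3]; simp [tbpPoint]; norm_num),
    key 1 3 1 (by norm_num) (by rw [norm_sub_sq_E3]; simp [tbpPoint]; nlinarith),
    key 1 4 1 (by norm_num) (by rw [norm_sub_sq_E3]; simp [tbpPoint]; nlinarith),
    key 2 3 (2 / 3) (by norm_num) (by rw [norm_sub_sq_E3]; simp [tbpPoint]; nlinarith),
    key 2 4 (2 / 3) (by norm_num) (by rw [norm_sub_sq_E3]; simp [tbpPoint]; nlinarith),
    key 3 4 (2 / 3) (by norm_num) (by rw [norm_sub_sq_E3]; simp [tbpPoint])]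
  rw [Real.one_rpow, tbpEnergy]
  ring

/-- Inverse stereographic projection. -/
theorem coords_of_stereo {v : E3} {p : E2} (hv : ‖v‖ = 1) (hn : v ≠ northPole) (h : stereo v = p) :
    v 0 = 2 * p 0 / (1 + p 0 ^ 2 + p 1 ^ 2) ∧ v 1 = 2 * p 1 / (1 + p 0 ^ 2 + p 1 ^ 2) ∧
      v 2 = 1 - 2 / (1 + p 0 ^ 2 + p 1 ^ 2) := by
  have hs : v 0 ^ 2 + v 1 ^ 2 + v 2 ^ 2 = 1 := by
    have := EuclideanSpace.norm_sq_eq v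
    rw [hv] at this
    simpa [Fin.sum_univ_three] using this.symm
  have hz : 1 - v 2 ≠ 0 := by
    intro hz
    have h2 : v 2 = 1 := by linarith
    rw [h2] at hs
    have h0 : v 0 = 0 := by nlinarith [sq_nonneg (v 0), sq_nonneg (v 1)]
    have h1 : v 1 = 0 := by nlinarith [sq_nonneg (v 0), sq_nonneg (v 1)]
    apply hn
    ext i
    fin_cases i <;> simp [northPole, h0, h1, h2]
  have p0 : p 0 = v 0 / (1 - v 2) := by rw [← h]; simp [stereo]
  have p1 : p 1 = v 1 / (1 - v 2) := by rw [← h]; simp [stereo]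
  have e : 1 + p 0 ^ 2 + p 1 ^ 2 = 2 / (1 - v 2) := by
    rw [p0, p1]; field_simp; linear_combination hs
  rw [e, p0, p1]
  refine ⟨?_, ?_, ?_⟩ <;> field_simp
  ring

theorem rpow_mul_energy_eq_pyramidEnergy {t x y : ℝ} (ht : 0 < t) (hx : 0 < x) (hy : 0 < y)
    {V : Configuration} {p : Fin 4 → E2} (hV : V.HasStereoCoords p)
    (h0 : p 0 0 = x ∧ p 0 1 = 0) (h1 : p 1 0 = 0 ∧ p 1 1 = -y)
    (h2 : p 2 0 = -x ∧ p 2 1 = 0) (h3 : p 3 0 = 0 ∧ p 3 1 = y) :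
    2 ^ t * energy (riesz (2 * t)) V = pyramidEnergy (fun r => r ^ t) (x ^ 2) (y ^ 2) := by
  have c4 : V.point 4 = northPole := hV.1
  have hc : ∀ k : Fin 4, _ := fun k => coords_of_stereo (V.norm_point k.castSucc)
    (fun h => (Fin.castSucc_lt_last k).ne (V.injective_point (h.trans hV.1.symm))) (hV.2 k)
  obtain ⟨a0, b0, c0⟩ := hc 0
  obtain ⟨a1, b1, c1⟩ := hc 1
  obtain ⟨a2, b2, c2⟩ := hc 2
  obtain ⟨a3, b3, c3⟩ := hc 3
  simp only [Fin.castSucc_zero, h0.1, h0.2] at a0 b0 c0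
  change V.point 1 0 = _ at a1
  change V.point 1 1 = _ at b1
  change V.point 1 2 = _ at c1
  change V.point 2 0 = _ at a2
  change V.point 2 1 = _ at b2
  change V.point 2 2 = _ at c2
  change V.point 3 0 = _ at a3
  change V.point 3 1 = _ at b3
  change V.point 3 2 = _ at c3
  rw [h1.1, h1.2] at a1 b1 c1
  rw [h2.1, h2.2] at a2 b2 c2
  rw [h3.1, h3.2] at a3 b3 c3
  have n0 : V.point 4 0 = 0 := by rw [c4]; simp [northPole]
  have n1 : V.point 4 1 = 0 := by rw [c4]; simp [northPole]
  have n2 : V.point 4 2 = 1 := by rw [c4]; simp [northPole]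
  have key : ∀ i j : Fin 5, ∀ q : ℝ, 0 < q → ‖V.point i - V.point j‖ ^ 2 = 2 / q →
      2 ^ t * riesz (2 * t) ‖V.point i - V.point j‖ = q ^ t := fun i j q hq h =>
    rpow_mul_riesz ht (norm_nonneg _) hq h
  have cross : 0 < (1 + x ^ 2) * (1 + y ^ 2) / (2 * (x ^ 2 + y ^ 2)) := by positivity
  rw [energy_eq_sum]
  simp only [mul_add]
  rw [key 0 1 _ cross (by rw [norm_sub_sq_E3, a0, b0, c0, a1, b1, c1]; field_simp; ring),
    key 0 2 ((1 + x ^ 2) ^ 2 / (8 * x ^ 2)) (by positivity)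
      (by rw [norm_sub_sq_E3, a0, b0, c0, a2, b2, c2]; field_simp; ring),
    key 0 3 _ cross (by rw [norm_sub_sq_E3, a0, b0, c0, a3, b3, c3]; field_simp; ring),
    key 0 4 ((1 + x ^ 2) / 2) (by positivity)
      (by rw [norm_sub_sq_E3, a0, b0, c0, n0, n1, n2]; field_simp; ring),
    key 1 2 _ cross (by rw [norm_sub_sq_E3, a1, b1, c1, a2, b2, c2]; field_simp; ring),
    key 1 3 ((1 + y ^ 2) ^ 2 / (8 * y ^ 2)) (by positivity)
      (by rw [norm_sub_sq_E3, a1, b1, c1, a3, b3, c3]; field_simp; ring),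
    key 1 4 ((1 + y ^ 2) / 2) (by positivity)
      (by rw [norm_sub_sq_E3, a1, b1, c1, n0, n1, n2]; field_simp; ring),
    key 2 3 _ cross (by rw [norm_sub_sq_E3, a2, b2, c2, a3, b3, c3]; field_simp; ring),
    key 2 4 ((1 + x ^ 2) / 2) (by positivity)
      (by rw [norm_sub_sq_E3, a2, b2, c2, n0, n1, n2]; field_simp; ring),
    key 3 4 ((1 + y ^ 2) / 2) (by positivity)
      (by rw [norm_sub_sq_E3, a3, b3, c3, n0, n1, n2]; field_simp; ring)]
  unfold pyramidEnergy
  ring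

theorem coords_of_mem_SMALL4 {p : Fin 4 → E2} (hp : p ∈ SMALL4) :
    ∃ x y : ℝ, (p 0 0 = x ∧ p 0 1 = 0) ∧ (p 1 0 = 0 ∧ p 1 1 = -y) ∧ (p 2 0 = -x ∧ p 2 1 = 0) ∧
      (p 3 0 = 0 ∧ p 3 1 = y) ∧ y ≤ x ∧ 348 / 512 ≤ y ∧ x ≤ 498 / 512 := by
  rcases hp with ⟨⟨-, hsum, -, hax⟩, hn, ⟨⟨l0, u0⟩, -⟩, ⟨-, l1, u1⟩, ⟨⟨l2, u2⟩, -⟩, -, l3, u3⟩ |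
    ⟨x, y, h2, h0, h1, h3, hyx, hx, hy⟩
  · have s0 := congrArg (fun v : E2 => v 0) hsum
    have s1 := congrArg (fun v : E2 => v 1) hsum
    simp only [PiLp.add_apply] at s0 s1
    -- Each box keeps one coordinate away from 0, so lying on the axes forces the other to vanish;
    -- the rhombus relation then makes opposite vertices antipodal.
    have e0 : p 0 1 = 0 := (hax 0).resolve_left (by intro h; rw [h] at l0; norm_num at l0)
    have e1 : p 1 0 = 0 := (hax 1).resolve_right (by intro h; rw [h] at u1; norm_num at u1)
    have e2 : p 2 1 = 0 := (hax 2).resolve_left (by intro h; rw [h] at u2; norm_num at u2)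
    have e3 : p 3 0 = 0 := (hax 3).resolve_right (by intro h; rw [h] at l3; norm_num at l3)
    refine ⟨p 0 0, p 3 1, ⟨rfl, e0⟩, ⟨e1, by linarith⟩, ⟨by linarith, e2⟩, ⟨e3, rfl⟩, ?_,
      by linarith, by linarith⟩
    have := pow_le_pow_left₀ (norm_nonneg _) (hn 3) 2
    rw [EuclideanSpace.norm_sq_eq, EuclideanSpace.norm_sq_eq] at this
    simp only [Fin.sum_univ_two, e3, e0, Real.norm_eq_abs, sq_abs] at this
    nlinarith
  · have c0 : p 0 0 = x ∧ p 0 1 = 0 := by simp [h0]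
    have c3 : p 3 0 = 0 ∧ p 3 1 = y := by simp [h3]
    have c2 : p 2 = -p 0 := by rw [← h2, neg_neg]
    have c1 : p 1 = -p 3 := by rw [← h1, neg_neg]
    refine ⟨x, y, c0, ?_, ?_, c3, hyx, hy.1, hx.2.trans (by norm_num)⟩
    · simp [c1, c3]
    · simp [c2, c0]

theorem mem_TINY4_of_coords {p : Fin 4 → E2} {x y : ℝ} (h0 : p 0 0 = x ∧ p 0 1 = 0)
    (h1 : p 1 0 = 0 ∧ p 1 1 = -y) (h2 : p 2 0 = -x ∧ p 2 1 = 0) (h3 : p 3 0 = 0 ∧ p 3 1 = y)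
    (hx : x ∈ Ioo (55 / 64 : ℝ) (56 / 64)) (hy : y ∈ Ioo (55 / 64 : ℝ) (56 / 64)) : p ∈ TINY4 := by
  have x0 : 0 < x := by linarith [hx.1]
  have y0 : 0 < y := by linarith [hy.1]
  refine ⟨⟨?_, ?_, ?_, ?_⟩, ?_, ?_, ?_, ?_⟩
  · intro i j hij
    have g0 := congrArg (fun v : E2 => v 0) hij
    have g1 := congrArg (fun v : E2 => v 1) hij
    fin_cases i <;> fin_cases j <;> simp [h0, h1, h2, h3] at g0 g1 ⊢ <;> linarith
  · ext i
    fin_cases i <;> simp [h0, h1, h2, h3]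
  · rw [EuclideanSpace.norm_eq, EuclideanSpace.norm_eq]
    simp [Fin.sum_univ_two, h0, h1, h2]
  · intro k
    fin_cases k <;> simp [h0, h1, h2, h3]
  · rw [h2.1, h2.2, neg_neg]; exact ⟨hx, neg_zero⟩
  · rw [h0.1, h0.2]; exact ⟨hx, rfl⟩
  · rw [h1.1, h1.2, neg_neg]; exact ⟨neg_zero, hy⟩
  · rw [h3.1, h3.2]; exact ⟨rfl, hy⟩

theorem lemma2p4 (s : ℝ) (X : Configuration)
    (h : (s ∈ Set.Icc (13 : ℝ) (15 + 24 / 512) ∧ X.Mem SMALL4) ∨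
      (s ∈ Set.Icc (15 + 24 / 512 : ℝ) (15 + 25 / 512) ∧ X.Mem (SMALL4 \ TINY4))) :
    energy (riesz s) X > energy (riesz s) TBP := by
  obtain ⟨p, V, hp, hV, hXV, hs, ht⟩ : ∃ (p : Fin 4 → E2) (V : Configuration), p ∈ SMALL4 ∧
      V.HasStereoCoords p ∧ X.Isometric V ∧ s ∈ Icc (13 : ℝ) (15 + 25 / 512) ∧
      (p ∈ TINY4 → s ≤ 15 + 24 / 512) := by
    rcases h with ⟨⟨s0, s1⟩, p, hp, V, hV, hXV⟩ | ⟨⟨s0, s1⟩, p, ⟨hp, hp'⟩, V, hV, hXV⟩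
    · exact ⟨p, V, hp, hV, hXV, ⟨s0, by linarith⟩, fun _ => s1⟩
    · exact ⟨p, V, hp, hV, hXV, ⟨by linarith, s1⟩, fun h => absurd h hp'⟩
  obtain ⟨x, y, h0, h1, h2, h3, hyx, hy, hx⟩ := coords_of_mem_SMALL4 hp
  obtain ⟨t, rfl⟩ : ∃ t, s = 2 * t := ⟨s / 2, by ring⟩
  have t0 : 0 < t := by linarith [hs.1]
  have hab : InRange (x ^ 2) (y ^ 2) := by
    refine ⟨?_, ?_, ?_, ?_⟩ <;> nlinarith
  have main : tbpEnergy t < pyramidEnergy (fun r => r ^ t) (x ^ 2) (y ^ 2) := by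
    by_cases hxy : x < 7 / 8 ∧ 55 / 64 < y
    · have hT := ht (mem_TINY4_of_coords h0 h1 h2 h3 ⟨by linarith, by linarith⟩
        ⟨by linarith, by linarith⟩)
      -- In the square, a - b is at most (7/8)² - (55/64)² = 111/4096 < 3/100.
      refine tbpEnergy_lt_of_square hab ?_ ⟨by linarith [hs.1], by linarith⟩
      nlinarith
    · refine tbpEnergy_lt_of_not_square hab ?_ ⟨by linarith [hs.1], by linarith [hs.2]⟩
      rw [not_and_or, not_lt, not_lt] at hxy
      exact hxy.imp (fun h => pow_le_pow_left₀ (by norm_num) h 2)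
        (fun h => pow_le_pow_left₀ (by linarith) h 2)
  rw [energy_eq_of_isometric _ hXV]
  rw [← rpow_mul_energy_TBP t0,
    ← rpow_mul_energy_eq_pyramidEnergy t0 (by linarith) (by linarith) hV h0 h1 h2 h3] at main
  exact lt_of_mul_lt_mul_left main (Real.rpow_nonneg (by norm_num) t)
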